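/- Let $d$ be a prime, $n,m\ge 0$ integers, and $\omega=e^{2\pi i/d}$, $\tau=(-1)^d e^{\pi i/d}$ (so $\tau^2=\omega$). On $n$ qudits, i.e. on $(\mathbb C^d)^{\otimes n}$ with computational basis $|x\rangle$, $x\in\mathbb F_d^n$, put $Z(z)|y\rangle=\omega^{z\cdot y}|y\rangle$ and $X(x)|y\rangle=|y+x\rangle$, and let the Pauli operators be $w(a)=\tau^{-a_z\cdot a_x}Z(a_z)X(a_x)$, $a=(a_z,a_x)\in\mathbb F_d^{2n}$ (the exponent being computed with the representatives $0,\dots,d-1$). The Pauli group $\mathcal P_n$ is the group generated by the $w(a)$; a Clifford unitary is a unitary $U$ with $U\mathcal P_nU^\dagger=\mathcal P_n$. A stabiliser group is an abelian subgroup $S\subset\mathcal P_n$ with $\omega\mathbb 1\notin S$; its stabiliser code is the space of common fixed points of $S$, a stabiliser code projector is the orthogonal projection onto a stabiliser code, and a stabiliser state is a stabiliser code projector of rank one. A stabiliser operation, i.e. an element of $\mathrm{SO}_{n,m}(d)$, is a map from operators on $n$ qudits to operators on $m$ qudits that is composed of the following fundamental operations: preparation of qudits in stabiliser states, application of Clifford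 unitaries, Pauli measurements (projective measurements of the eigenspaces of some $w(a)$ on all qudits present), and discarding of qudits, where an arbitrary random function (with countably many values) of the previous measurement outcomes may be used to decide which fundamental operation to perform in each step. Such a realisation has at most $t$ rounds if at most $t$ Pauli measurements are performed, one after another, in each of its runs. Consider the maps $\mathcal E\in\mathrm{SO}_{n,m}(d)$ of the form $$\mathcal E(\rho)=\operatorname{tr}_{m+1,\dots,n+r}\sum_i U_i\big(P_i\rho P_i\otimes|0^r\rangle\langle 0^r|\big)U_i^\dagger \qquad (*)$$ for some $r\ge 0$ with $n+r\ge m$, some finite family $(P_i)$ of mutually orthogonal stabiliser code projectors on $n$ qudits with $\sum_iP_i=\mathbb 1$, and some Clifford unitaries $U_i$ on $n+r$ qudits. Theorem (Kraus decomposition of SO). Let $\mathcal O\in\mathrm{SO}_{n,m}(d)$. Then: (i) $\mathcal O$ is a (finite) convex combination of elements of $\mathrm{SO}_{n,m}(d)$ of the form $(*)$. (ii) $\mathcal O$ can be realised in at most $n$ rounds. -/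

import Mathlib

open scoped Matrix

noncomputable section

/-- Operators on `n` qudits of dimension `d`, as matrices in the computational basis `|x⟩`,
`x ∈ 𝔽_d ^ n`. -/
abbrev QOp (d n : ℕ) : Type := Matrix (Fin n → ZMod d) (Fin n → ZMod d) ℂ

/-- Unitary operators on `n` qudits. -/
abbrev QUnitary (d n : ℕ) [Fact d.Prime] : Type :=
  ↥(Matrix.unitaryGroup (Fin n → ZMod d) ℂ)

/-- Superoperators taking `n` qudits to `m` qudits. -/
abbrev QMap (d n m : ℕ) : Type := QOp d n →ₗ[ℂ] QOp d m

section Pauli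

/-- `τ = (-1)^d e^{iπ/d}`, a square root of `ω = e^{2πi/d}`. The powers `ω ^ x`, `x ∈ 𝔽_d`, are
written `ZMod.stdAddChar x`. -/
def qTau (d : ℕ) : ℂ := (-1) ^ d * Complex.exp (Real.pi * Complex.I / d)

/-- `Z(z)|y⟩ = ω^{z·y}|y⟩`. -/
def pauliZ {d n : ℕ} [Fact d.Prime] (z : Fin n → ZMod d) : QOp d n :=
  Matrix.diagonal fun y => ZMod.stdAddChar (z ⬝ᵥ y)

/-- `X(x)|y⟩ = |y + x⟩`. -/
def pauliX {d n : ℕ} (x : Fin n → ZMod d) : QOp d n :=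
  Matrix.of fun y' y => if y' = y + x then 1 else 0

/-- The Pauli operator `w(a) = τ^{-a_z·a_x} Z(a_z) X(a_x)` with `a = (a_z, a_x)`; the exponent is
computed from the representatives in `{0, …, d-1}`. -/
def weyl {d n : ℕ} [Fact d.Prime] (a : (Fin n → ZMod d) × (Fin n → ZMod d)) : QOp d n :=
  (qTau d)⁻¹ ^ (∑ i, (a.1 i).val * (a.2 i).val) • (pauliZ a.1 * pauliX a.2)

theorem pauliZ_mem_unitaryGroup {d n : ℕ} [Fact d.Prime] (z : Fin n → ZMod d) :
    pauliZ z ∈ Matrix.unitaryGroup (Fin n → ZMod d) ℂ := by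
  rw [Matrix.mem_unitaryGroup_iff, Matrix.star_eq_conjTranspose, pauliZ,
    Matrix.diagonal_conjTranspose, Matrix.diagonal_mul_diagonal, ← Matrix.diagonal_one]
  congr 1
  funext y
  have h : ‖(ZMod.stdAddChar (z ⬝ᵥ y) : ℂ)‖ = 1 := AddChar.norm_apply _ _
  simp [Complex.mul_conj, Complex.normSq_eq_norm_sq, h]

theorem pauliX_mem_unitaryGroup {d n : ℕ} [Fact d.Prime] (x : Fin n → ZMod d) :
    pauliX x ∈ Matrix.unitaryGroup (Fin n → ZMod d) ℂ := by
  rw [Matrix.mem_unitaryGroup_iff, Matrix.star_eq_conjTranspose]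
  ext y y'
  have h : ∀ w j : Fin n → ZMod d, (w = j + x) ↔ (w - x = j) := fun w j =>
    sub_eq_iff_eq_add.symm
  simp [pauliX, Matrix.mul_apply, Matrix.one_apply, h, eq_comm]

theorem norm_qTau (d : ℕ) : ‖qTau d‖ = 1 := by
  have h : (Real.pi * Complex.I / d : ℂ) = ((Real.pi / d : ℝ) : ℂ) * Complex.I := by
    push_cast; ring
  rw [qTau, norm_mul, h, Complex.norm_exp_ofReal_mul_I]
  simp

theorem weyl_mem_unitaryGroup {d n : ℕ} [Fact d.Prime]
    (a : (Fin n → ZMod d) × (Fin n → ZMod d)) :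
    weyl a ∈ Matrix.unitaryGroup (Fin n → ZMod d) ℂ := by
  have hZX := mul_mem (pauliZ_mem_unitaryGroup a.1) (pauliX_mem_unitaryGroup a.2)
  rw [Matrix.mem_unitaryGroup_iff] at hZX ⊢
  have hc : ‖(qTau d)⁻¹ ^ (∑ i, (a.1 i).val * (a.2 i).val)‖ = 1 := by
    simp [norm_qTau]
  rw [weyl, star_smul, smul_mul_smul_comm, hZX, Complex.star_def, Complex.mul_conj,
    Complex.normSq_eq_norm_sq, hc]
  simp

/-- The Pauli operator `w(a)` as a unitary. -/
def weylUnitary {d n : ℕ} [Fact d.Prime] (a : (Fin n → ZMod d) × (Fin n → ZMod d)) :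
    QUnitary d n :=
  ⟨weyl a, weyl_mem_unitaryGroup a⟩

/-- The (generalised) Pauli group, generated by the Pauli operators. -/
def pauliGroup (d n : ℕ) [Fact d.Prime] : Subgroup (QUnitary d n) :=
  Subgroup.closure (Set.range weylUnitary)

/-- The group of Clifford unitaries `U`, i.e. `U 𝒫 U† = 𝒫`. Global phases are not divided out:
Clifford unitaries only ever act by conjugation. -/
def cliffordGroup (d n : ℕ) [Fact d.Prime] : Subgroup (QUnitary d n) :=
  Subgroup.normalizer (pauliGroup d n : Set (QUnitary d n))

end Pauli

section Codes

/-- `P` is the orthogonal projection onto the subspace `C`. -/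
def IsProjectorOnto {d n : ℕ} [Fact d.Prime] (P : QOp d n)
    (C : Submodule ℂ ((Fin n → ZMod d) → ℂ)) : Prop :=
  IsStarProjection P ∧ ∀ v, P *ᵥ v = v ↔ v ∈ C

/-- A stabiliser group: an abelian subgroup of the Pauli group that does not contain `ω 𝟙`. -/
structure IsStabiliserGroup {d n : ℕ} [Fact d.Prime] (S : Subgroup (QUnitary d n)) : Prop where
  le_pauliGroup : S ≤ pauliGroup d n
  comm : ∀ s ∈ S, ∀ t ∈ S, s * t = t * s
  omega_notMem : ∀ s ∈ S, (s : QOp d n) ≠ (ZMod.stdAddChar (1 : ZMod d) : ℂ) • (1 : QOp d n)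

/-- The subspace `C(S)` of common fixed points of `S`. -/
def stabiliserCode {d n : ℕ} [Fact d.Prime] (S : Subgroup (QUnitary d n)) :
    Submodule ℂ ((Fin n → ZMod d) → ℂ) where
  carrier := {v | ∀ s ∈ S, (s : QOp d n) *ᵥ v = v}
  add_mem' := fun ha hb s hs => by rw [Matrix.mulVec_add, ha s hs, hb s hs]
  zero_mem' := fun s _ => Matrix.mulVec_zero _
  smul_mem' := fun c v hv s hs => by rw [Matrix.mulVec_smul, hv s hs]

/-- `P` is the orthogonal projection onto some stabiliser code. -/
def IsCodeProjector {d n : ℕ} [Fact d.Prime] (P : QOp d n) : Prop :=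
  ∃ S : Subgroup (QUnitary d n), IsStabiliserGroup S ∧ IsProjectorOnto P (stabiliserCode S)

/-- `σ = |s⟩⟨s|` for a pure stabiliser state `|s⟩`. -/
def IsStabiliserState {d n : ℕ} [Fact d.Prime] (σ : QOp d n) : Prop :=
  IsCodeProjector σ ∧ σ.rank = 1

/-- The projector `|0^r⟩⟨0^r|`. -/
def zeroState (d r : ℕ) : QOp d r := Matrix.single 0 0 1

end Codes

section Operations

/-- `ρ ↦ ρ ⊗ σ`: append `k` qudits in the state `σ` to `n` qudits. -/
def appendState {d n k : ℕ} (σ : QOp d k) : QMap d n (n + k) where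
  toFun ρ := Matrix.of fun x y =>
    ρ (fun i => x (Fin.castAdd k i)) (fun i => y (Fin.castAdd k i)) *
      σ (fun j => x (Fin.natAdd n j)) (fun j => y (Fin.natAdd n j))
  map_add' ρ ρ' := by ext x y; simp [add_mul]
  map_smul' c ρ := by ext x y; simp [mul_assoc]

/-- `ρ ↦ K ρ K†`. -/
def conjMap {d n : ℕ} [Fact d.Prime] (K : QOp d n) : QMap d n n where
  toFun ρ := K * ρ * Kᴴ
  map_add' ρ ρ' := by rw [mul_add, add_mul]
  map_smul' c ρ := by simp

/-- The string `x_1 … x_m z_1 … z_{N-m}`. -/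
def extendString {d m N : ℕ} (h : m ≤ N) (x : Fin m → ZMod d) (z : Fin (N - m) → ZMod d) :
    Fin N → ZMod d :=
  fun i => Fin.append x z (Fin.cast (Nat.add_sub_of_le h).symm i)

/-- The partial trace over the qudits `m+1, …, N` of an `N`-qudit system. -/
def partialTrace {d m N : ℕ} [Fact d.Prime] (h : m ≤ N) : QMap d N m where
  toFun A := Matrix.of fun x y => ∑ z : Fin (N - m) → ZMod d,
    A (extendString h x z) (extendString h y z)
  map_add' A B := by ext x y; simp [Finset.sum_add_distrib]
  map_smul' c A := by ext x y; simp [Finset.mul_sum]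

/-- `StabProtocol d m t n E`: the superoperator `E` from `n` to `m` qudits is realised by an
adaptive protocol made of fundamental stabiliser operations, in which every run has at most `t`
rounds. A round begins with one Pauli measurement, whose outcome is available to everything that
follows; `t = ⊤` means that the number of rounds is not restricted.

A protocol either stops, or performs a first step and goes on with a protocol that may depend on the
outcome of a measurement or on the value of a (discrete) random variable. Qudits are appended and
discarded at the end of the register; as permutations of qudits are Clifford unitaries this is no
restriction. -/
inductive StabProtocol (d m : ℕ) [Fact d.Prime] : ℕ∞ → (n : ℕ) → QMap d n m → Prop
  | done (t : ℕ∞) : StabProtocol d m t m LinearMap.id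
  | prepare {t : ℕ∞} {n k : ℕ} (σ : QOp d k) (hσ : IsStabiliserState σ)
      (E : QMap d (n + k) m) (hE : StabProtocol d m t (n + k) E) :
      StabProtocol d m t n (E ∘ₗ appendState σ)
  | clifford {t : ℕ∞} {n : ℕ} (U : QUnitary d n) (hU : U ∈ cliffordGroup d n)
      (E : QMap d n m) (hE : StabProtocol d m t n E) :
      StabProtocol d m t n (E ∘ₗ conjMap (U : QOp d n))
  | discard {t : ℕ∞} {n n' : ℕ} (h : n' ≤ n)
      (E : QMap d n' m) (hE : StabProtocol d m t n' E) :
      StabProtocol d m t n (E ∘ₗ partialTrace h)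
  | measure {s t : ℕ∞} (hst : s + 1 ≤ t) {n : ℕ} (a : (Fin n → ZMod d) × (Fin n → ZMod d))
      (P : ZMod d → QOp d n)
      (hP : ∀ x, IsProjectorOnto (P x)
        (Module.End.eigenspace (Matrix.toLin' (weyl a)) (ZMod.stdAddChar x)))
      (E : ZMod d → QMap d n m) (hE : ∀ x, StabProtocol d m s n (E x)) :
      StabProtocol d m t n (∑ x, E x ∘ₗ conjMap (P x))
  | random {t : ℕ∞} {n : ℕ} (p : ℕ → ℝ) (hp : ∀ j, 0 ≤ p j) (hp1 : HasSum p 1)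
      (E : ℕ → QMap d n m) (hE : ∀ j, StabProtocol d m t n (E j))
      (F : QMap d n m) (hF : ∀ ρ, HasSum (fun j => p j • E j ρ) (F ρ)) :
      StabProtocol d m t n F

/-- The set `SO_{n,m}(d)` of stabiliser operations. -/
def stabiliserOperations (d n m : ℕ) [Fact d.Prime] : Set (QMap d n m) :=
  {E | StabProtocol d m ⊤ n E}

/-- `E(ρ) = tr_{m+1,…,n+r} ∑ i, U_i (P_i ρ P_i ⊗ |0^r⟩⟨0^r|) U_i†`, where `{P_i}` is a projective
measurement consisting of mutually orthogonal stabiliser code projectors on the `n` input qudits and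
the `U_i` are Clifford unitaries on `n + r` qudits. -/
def IsCodeMeasurementForm {d n m : ℕ} [Fact d.Prime] (E : QMap d n m) : Prop :=
  ∃ (r : ℕ) (h : m ≤ n + r) (N : ℕ) (P : Fin N → QOp d n) (U : Fin N → QUnitary d (n + r)),
    (∀ i, IsCodeProjector (P i)) ∧
    (∀ i j, i ≠ j → P i * P j = 0) ∧
    ∑ i, P i = 1 ∧
    (∀ i, U i ∈ cliffordGroup d (n + r)) ∧
    ∀ ρ, E ρ = partialTrace h (∑ i,
      (U i : QOp d (n + r)) * appendState (zeroState d r) (P i * ρ * P i) *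
        (U i : QOp d (n + r))ᴴ)

end Operations

end

/-! The proof runs a protocol while keeping its state so far in the form `ρ ↦ tr (U J P ρ P J† U†)`,
where `P` is a code projector of rank `d ^ k` on the input, the isometry `J` pads the register with
zeros, and `U` is Clifford. Preparation enlarges `J` and changes `U`, because every stabiliser state
is a Clifford image of `|0…0⟩`. Clifford unitaries are absorbed into `U`, and discarding is absorbed
into the trace.

The content is in the Pauli measurements. Pulled back through `U`, a measurement becomes that of a
phased Pauli operator `B` on the range of `J P` (`pauli_dichotomy`, `IsCode.measure`): (a) Some
Pauli `A` fixing `J P` does not commute with `B`. Then the spectral projection of `B` for outcome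
`x` acts on `J P` as `d^{-1/2} V_x` with `V_x` Clifford, a Fourier transform built from the pair
`A`, `B` (`exists_clifford_of_noncomm`). The measurement is thus a uniformly random Clifford
unitary. (b) Otherwise `B` acts on the range of `J` as `ω ^ c w(b)` for a Pauli operator `w(b)` on
the input qudits that commutes with `P`. If `w(b)` is scalar on `P`, the outcome is certain and
nothing happens. (c) If `w(b)` is not scalar on `P`, the outcomes split the code into `d` orthogonal
codes of rank `d ^ (k - 1)`.

Only case (c) needs a measurement, and each occurrence lowers `k`. Starting from `P = 1`, `k = n`,
one arrives at convex combinations of `CodeTree`s of depth at most `n`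
(`StabProtocol.comp_mem_convexHull`). Such a tree is a protocol with at most `n` rounds, and its
leaves form one projective measurement by code projectors followed by Clifford unitaries, as in
`(*)`.

Countable randomness yields countable convex combinations. These stay inside the convex hull since a
convex set in finite dimension, closed or not, is stable under them (`Convex.mem_of_hasSum`). -/

noncomputable section

/-! ### Phases, commutators and traces of Pauli operators. -/

section PauliAlgebra

variable {d n : ℕ} [Fact d.Prime]

/-- The index set of Pauli operators on `n` qudits. -/
abbrev PauliIndex (d n : ℕ) : Type := (Fin n → ZMod d) × (Fin n → ZMod d)

/-- The Pauli operator `Z(a_z) X(a_x)` without its phase. -/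
def shiftClock (a : PauliIndex d n) : QOp d n := pauliZ a.1 * pauliX a.2

theorem shiftClock_apply (a : PauliIndex d n) (x y : Fin n → ZMod d) :
    shiftClock a x y = if x = y + a.2 then (ZMod.stdAddChar (a.1 ⬝ᵥ x) : ℂ) else 0 := by
  simp [shiftClock, pauliZ, pauliX, Matrix.diagonal_mul]

theorem shiftClock_mul_apply (a : PauliIndex d n) {α : Type*}
    (M : Matrix (Fin n → ZMod d) α ℂ) (x : Fin n → ZMod d) (y : α) :
    (shiftClock a * M) x y = ZMod.stdAddChar (a.1 ⬝ᵥ x) * M (x - a.2) y := by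
  rw [Matrix.mul_apply, Finset.sum_eq_single (x - a.2)]
  · simp [shiftClock_apply]
  · intro z _ hz
    rw [shiftClock_apply, if_neg, zero_mul]
    rintro rfl
    simp at hz
  · simp

theorem mul_shiftClock_apply (a : PauliIndex d n) {α : Type*}
    (M : Matrix α (Fin n → ZMod d) ℂ) (x : α) (y : Fin n → ZMod d) :
    (M * shiftClock a) x y = M x (y + a.2) * ZMod.stdAddChar (a.1 ⬝ᵥ (y + a.2)) := by
  rw [Matrix.mul_apply, Finset.sum_eq_single (y + a.2)]
  · simp [shiftClock_apply]
  · intro z _ hz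
    rw [shiftClock_apply, if_neg hz, mul_zero]
  · simp

theorem shiftClock_zero : shiftClock (0 : PauliIndex d n) = 1 := by
  ext x y
  simp [shiftClock_apply, Matrix.one_apply]

theorem shiftClock_mul (a b : PauliIndex d n) :
    shiftClock a * shiftClock b =
      (ZMod.stdAddChar (-(b.1 ⬝ᵥ a.2)) : ℂ) • shiftClock (a + b) := by
  ext x y
  rw [shiftClock_mul_apply, Matrix.smul_apply, shiftClock_apply, shiftClock_apply, smul_eq_mul]
  have h : x - a.2 = y + b.2 ↔ x = y + (a + b).2 := by
    rw [sub_eq_iff_eq_add, Prod.snd_add, add_assoc, add_comm b.2]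
  simp only [h]
  split_ifs
  · rw [← AddChar.map_add_eq_mul, ← AddChar.map_add_eq_mul]
    congr 1
    simp only [Prod.fst_add, add_dotProduct, dotProduct_sub]
    ring
  · simp

theorem shiftClock_comm (a b : PauliIndex d n) :
    shiftClock a * shiftClock b =
      (ZMod.stdAddChar (a.1 ⬝ᵥ b.2 - b.1 ⬝ᵥ a.2) : ℂ) • (shiftClock b * shiftClock a) := by
  rw [shiftClock_mul, shiftClock_mul, smul_smul, ← AddChar.map_add_eq_mul, add_comm b a]
  congr 2
  ring

theorem stdAddChar_ne_zero (k : ZMod d) : (ZMod.stdAddChar k : ℂ) ≠ 0 := by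
  intro h
  have h1 : ‖(ZMod.stdAddChar k : ℂ)‖ = 1 := AddChar.norm_apply _ _
  simp [h] at h1

theorem shiftClock_ne_zero (a : PauliIndex d n) : shiftClock a ≠ 0 := by
  intro h
  have h1 := shiftClock_mul a (-a)
  rw [add_neg_cancel, shiftClock_zero, h, zero_mul] at h1
  exact (smul_ne_zero (stdAddChar_ne_zero _) one_ne_zero) h1.symm

theorem weyl_eq_smul (a : PauliIndex d n) :
    weyl a = (qTau d)⁻¹ ^ (∑ i, (a.1 i).val * (a.2 i).val) • shiftClock a := rfl

/-- The scalar is left unspecified. Where its value matters, it is recovered from the condition that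
the `d`-th power is `1`. -/
theorem exists_eq_smul_shiftClock {g : QUnitary d n} (hg : g ∈ pauliGroup d n) :
    ∃ (c : ℂ) (a : PauliIndex d n), c ≠ 0 ∧ (g : QOp d n) = c • shiftClock a := by
  have ht : qTau d ≠ 0 := by
    intro h
    simpa [h] using norm_qTau d
  induction hg using Subgroup.closure_induction with
  | mem x hx =>
    obtain ⟨a, rfl⟩ := hx
    exact ⟨_, a, pow_ne_zero _ (inv_ne_zero ht), rfl⟩
  | one => exact ⟨1, 0, one_ne_zero, by simp [shiftClock_zero]⟩
  | mul x y _ _ hx hy =>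
    obtain ⟨c, a, hc, hx⟩ := hx
    obtain ⟨e, b, he, hy⟩ := hy
    refine ⟨c * e * ZMod.stdAddChar (-(b.1 ⬝ᵥ a.2)), a + b,
      mul_ne_zero (mul_ne_zero hc he) (stdAddChar_ne_zero _), ?_⟩
    rw [Submonoid.coe_mul, hx, hy, smul_mul_smul_comm, shiftClock_mul, smul_smul]
  | inv x _ hx =>
    obtain ⟨c, a, hc, hx⟩ := hx
    refine ⟨c⁻¹ * (ZMod.stdAddChar (-((-a).1 ⬝ᵥ a.2)))⁻¹, -a,
      mul_ne_zero (inv_ne_zero hc) (inv_ne_zero (stdAddChar_ne_zero _)), ?_⟩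
    have h1 : (x : QOp d n) * ((c⁻¹ * (ZMod.stdAddChar (-((-a).1 ⬝ᵥ a.2)))⁻¹) •
        shiftClock (-a)) = 1 := by
      rw [hx, smul_mul_smul_comm, shiftClock_mul, smul_smul, add_neg_cancel, shiftClock_zero]
      have := stdAddChar_ne_zero (-((-a).1 ⬝ᵥ a.2))
      field_simp
      simp
    have h2 : ((x⁻¹ : QUnitary d n) : QOp d n) * (x : QOp d n) = 1 := by
      rw [← Submonoid.coe_mul, inv_mul_cancel, Submonoid.coe_one]
    exact left_inv_eq_right_inv h2 h1

theorem exists_commutation {g h : QUnitary d n} (hg : g ∈ pauliGroup d n)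
    (hh : h ∈ pauliGroup d n) :
    ∃ k : ZMod d, (g : QOp d n) * h = (ZMod.stdAddChar k : ℂ) • ((h : QOp d n) * g) := by
  obtain ⟨c, a, -, hg⟩ := exists_eq_smul_shiftClock hg
  obtain ⟨e, b, -, hh⟩ := exists_eq_smul_shiftClock hh
  refine ⟨a.1 ⬝ᵥ b.2 - b.1 ⬝ᵥ a.2, ?_⟩
  rw [hg, hh, smul_mul_smul_comm, smul_mul_smul_comm, shiftClock_comm, smul_comm, mul_comm e c]

theorem weylUnitary_mem (a : PauliIndex d n) : weylUnitary a ∈ pauliGroup d n :=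
  Subgroup.subset_closure ⟨a, rfl⟩

/-- Nondegeneracy of the symplectic form `a.1 ⬝ᵥ b.2 - b.1 ⬝ᵥ a.2`, tested on unit vectors. -/
theorem exists_weyl_noncomm {a : PauliIndex d n} (ha : a ≠ 0) :
    ∃ (b : PauliIndex d n) (k : ZMod d), k ≠ 0 ∧
      shiftClock a * weyl b = (ZMod.stdAddChar k : ℂ) • (weyl b * shiftClock a) := by
  have key : ∃ b : PauliIndex d n, a.1 ⬝ᵥ b.2 - b.1 ⬝ᵥ a.2 ≠ 0 := by
    by_contra! H
    apply ha
    ext i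
    · simpa using H (0, Pi.single i 1)
    · simpa using H (Pi.single i 1, 0)
  obtain ⟨b, hb⟩ := key
  refine ⟨b, _, hb, ?_⟩
  rw [weyl_eq_smul, mul_smul_comm, smul_mul_assoc, shiftClock_comm, smul_comm]

theorem stdAddChar_ne_one {k : ZMod d} (hk : k ≠ 0) : (ZMod.stdAddChar k : ℂ) ≠ 1 := by
  rw [← AddChar.map_zero_eq_one (ZMod.stdAddChar (N := d))]
  exact fun h => hk (ZMod.injective_stdAddChar h)

/-- Conjugation by a noncommuting Pauli operator preserves the trace but multiplies the operator by
a root of unity other than `1`. -/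
theorem trace_shiftClock {a : PauliIndex d n} (ha : a ≠ 0) : (shiftClock a).trace = 0 := by
  obtain ⟨b, k, hk, h⟩ := exists_weyl_noncomm ha
  have hu : weyl b * star (weyl b) = 1 := (weyl_mem_unitaryGroup b).2
  have hu' : star (weyl b) * weyl b = 1 := (weyl_mem_unitaryGroup b).1
  have h1 : (shiftClock a).trace = ZMod.stdAddChar k * (shiftClock a).trace := by
    calc (shiftClock a).trace = (star (weyl b) * (shiftClock a * weyl b)).trace := by
          rw [Matrix.trace_mul_comm, mul_assoc, hu, mul_one]
      _ = _ := by rw [h, mul_smul_comm, ← mul_assoc, hu', one_mul, Matrix.trace_smul, smul_eq_mul]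
  by_contra h0
  exact stdAddChar_ne_one hk (mul_right_cancel₀ h0 (by rw [one_mul]; exact h1.symm))

theorem eq_smul_one_of_trace_ne_zero {g : QUnitary d n} (hg : g ∈ pauliGroup d n)
    (h : (g : QOp d n).trace ≠ 0) : ∃ c : ℂ, c ≠ 0 ∧ (g : QOp d n) = c • 1 := by
  obtain ⟨c, a, hc, hg⟩ := exists_eq_smul_shiftClock hg
  by_cases ha : a = 0
  · exact ⟨c, hc, by rw [hg, ha, shiftClock_zero]⟩
  · rw [hg, Matrix.trace_smul, trace_shiftClock ha, smul_zero] at h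
    exact absurd rfl h

/-- The scalar unitary `ω ^ k 𝟙`. -/
def phaseUnitary (n : ℕ) (k : ZMod d) : QUnitary d n :=
  ⟨(ZMod.stdAddChar k : ℂ) • 1, by
    have h : ‖(ZMod.stdAddChar k : ℂ)‖ = 1 := AddChar.norm_apply _ _
    rw [Matrix.mem_unitaryGroup_iff, star_smul, smul_mul_smul_comm, Complex.star_def,
      Complex.mul_conj, Complex.normSq_eq_norm_sq, h]
    simp⟩

theorem coe_phaseUnitary (k : ZMod d) :
    (phaseUnitary n k : QOp d n) = (ZMod.stdAddChar k : ℂ) • 1 := rfl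

theorem phaseUnitary_pow (k : ZMod d) (j : ℕ) : phaseUnitary n k ^ j = phaseUnitary n ((j : ZMod d) * k) := by
  apply Subtype.ext
  rw [SubmonoidClass.coe_pow, coe_phaseUnitary, coe_phaseUnitary, smul_pow, one_pow,
    ← AddChar.map_nsmul_eq_pow, nsmul_eq_mul]

/-- The commutator of `g` and `h` is `ω ^ k`, whose powers exhaust all `ω ^ x` because `d` is prime.
Without a noncommuting pair this can fail: for `n = 0` the Pauli group is trivial. -/
theorem phaseUnitary_mem {g h : QUnitary d n} (hg : g ∈ pauliGroup d n) (hh : h ∈ pauliGroup d n)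
    {k : ZMod d} (hk : k ≠ 0)
    (hgh : (g : QOp d n) * h = (ZMod.stdAddChar k : ℂ) • ((h : QOp d n) * g)) (x : ZMod d) :
    phaseUnitary n x ∈ pauliGroup d n := by
  have h1 : g * h * g⁻¹ * h⁻¹ = phaseUnitary n k := by
    rw [mul_inv_eq_iff_eq_mul, mul_inv_eq_iff_eq_mul]
    apply Subtype.ext
    rw [Submonoid.coe_mul, hgh, Submonoid.coe_mul, Submonoid.coe_mul, coe_phaseUnitary,
      smul_mul_assoc, smul_mul_assoc, one_mul]
  have h2 : phaseUnitary n k ∈ pauliGroup d n := h1 ▸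
    mul_mem (mul_mem (mul_mem hg hh) (inv_mem hg)) (inv_mem hh)
  have h3 := pow_mem h2 (x * k⁻¹).val
  rwa [phaseUnitary_pow, ZMod.natCast_zmod_val, inv_mul_cancel_right₀ hk] at h3

theorem shiftClock_pow (a : PauliIndex d n) (j : ℕ) :
    shiftClock a ^ j =
      (ZMod.stdAddChar (-((j.choose 2 : ZMod d) * (a.1 ⬝ᵥ a.2))) : ℂ) • shiftClock (j • a) := by
  induction j with
  | zero => simp [shiftClock_zero]
  | succ j ih =>
    rw [pow_succ, ih, smul_mul_assoc, shiftClock_mul, smul_smul, ← AddChar.map_add_eq_mul,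
      succ_nsmul]
    congr 2
    rw [Nat.choose_succ_succ' j 1, Nat.choose_one_right]
    rw [Prod.smul_snd, dotProduct_smul, nsmul_eq_mul]
    push_cast
    ring

theorem qTau_sq : qTau d ^ 2 = ZMod.stdAddChar (1 : ZMod d) := by
  have h := ZMod.stdAddChar_coe (N := d) 1
  rw [Int.cast_one] at h
  rw [h, qTau, mul_pow, ← pow_mul, mul_comm d 2, pow_mul, neg_one_sq, one_pow, one_mul,
    ← Complex.exp_nat_mul]
  congr 1
  push_cast
  ring

theorem qTau_pow_mul_self : qTau d ^ (d * d) = 1 := by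
  have hd : (d : ℂ) ≠ 0 := Nat.cast_ne_zero.2 (Fact.out : d.Prime).ne_zero
  have h : qTau d ^ d = (-1) ^ (d * d + 1) := by
    rw [qTau, mul_pow, ← Complex.exp_nat_mul, mul_div_cancel₀ _ hd, Complex.exp_pi_mul_I,
      ← pow_mul, pow_succ]
  rw [pow_mul, h, ← pow_mul]
  apply Even.neg_one_pow
  rcases Nat.even_or_odd d with h | h
  · exact h.mul_left _
  · exact ((h.mul h).add_odd odd_one).mul_right _

theorem weyl_pow_d (a : PauliIndex d n) : weyl a ^ d = 1 := by
  have ht : qTau d ≠ 0 := by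
    intro h
    simpa [h] using norm_qTau d
  set e : ℕ := ∑ i, (a.1 i).val * (a.2 i).val with he
  have hdot : a.1 ⬝ᵥ a.2 = (e : ZMod d) := by
    simp [he, dotProduct]
  have hz : d • a = 0 := by
    ext i <;> simp
  rw [weyl_eq_smul, smul_pow, shiftClock_pow, hz, shiftClock_zero, smul_smul, hdot, ← he]
  have h1 : (ZMod.stdAddChar (-((d.choose 2 : ZMod d) * (e : ZMod d))) : ℂ) =
      ((qTau d ^ 2) ^ (d.choose 2 * e))⁻¹ := by
    rw [AddChar.map_neg_eq_inv, qTau_sq, ← AddChar.map_nsmul_eq_pow]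
    simp
  -- Total exponent of `τ⁻¹`: `d * e` from the prefactor of `w(a)` and, since `ω = τ ^ 2`, twice
  -- `d.choose 2 * e` from reordering. It is a multiple of `d ^ 2`, which works for `d = 2` as well.
  have h2 : d * e + 2 * (d.choose 2 * e) = d * d * e := by
    have h3 : d.choose 2 * 2 = d * (d - 1) := by
      rw [Nat.choose_two_right, Nat.div_mul_cancel (Nat.even_mul_pred_self d).two_dvd]
    obtain ⟨c, hc⟩ : ∃ c, d = c + 1 := ⟨d - 1, by have := (Fact.out : d.Prime).pos; omega⟩
    rw [← mul_assoc, mul_comm 2, h3, ← add_mul]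
    congr 1
    rw [hc]
    simp
    ring
  rw [h1, ← pow_mul, ← pow_mul, inv_pow, ← mul_inv, ← pow_add, mul_comm e d, h2, pow_mul,
    qTau_pow_mul_self]
  simp

/-- A phased Pauli operator of order `d` is `ω ^ c w(a)`. -/
theorem eq_stdAddChar_smul_weyl {c : ℂ} {a : PauliIndex d n}
    (h : (c • shiftClock a) ^ d = 1) :
    ∃ k : ZMod d, c • shiftClock a = (ZMod.stdAddChar k : ℂ) • weyl a := by
  have ht : qTau d ≠ 0 := by
    intro h
    simpa [h] using norm_qTau d
  set e : ℕ := ∑ i, (a.1 i).val * (a.2 i).val with he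
  have h1 : c • shiftClock a = (c * qTau d ^ e) • weyl a := by
    rw [weyl_eq_smul, smul_smul, ← he, mul_assoc, ← mul_pow, mul_inv_cancel₀ ht, one_pow, mul_one]
  have h2 : (c * qTau d ^ e) ^ d = 1 := by
    rw [h1, smul_pow, weyl_pow_d] at h
    have := congrFun (congrFun h 0) 0
    simpa using this
  have hd : d ≠ 0 := (Fact.out : d.Prime).ne_zero
  have hprim : IsPrimitiveRoot (ZMod.stdAddChar (1 : ZMod d) : ℂ) d := by
    have h := ZMod.stdAddChar_coe (N := d) 1
    rw [Int.cast_one] at h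
    rw [h]
    convert Complex.isPrimitiveRoot_exp d hd using 2
    push_cast
    ring
  have : NeZero d := ⟨hd⟩
  obtain ⟨i, -, hi⟩ := hprim.eq_pow_of_pow_eq_one h2
  refine ⟨i, ?_⟩
  rw [h1, ← hi, ← AddChar.map_nsmul_eq_pow, nsmul_one]

end PauliAlgebra

/-! ### Spectral projections of operators of order `d`. -/

section SpectralProjections

variable {d : ℕ} [Fact d.Prime] {I : Type*} [Fintype I] [DecidableEq I] {α : Type*}

/-- The projection onto the `ω ^ x`-eigenspace of a unitary `B` with `B ^ d = 1`. -/
def spectralProj (B : Matrix I I ℂ) (x : ZMod d) : Matrix I I ℂ :=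
  (d : ℂ)⁻¹ • ∑ j : ZMod d, (ZMod.stdAddChar (-(x * j)) : ℂ) • B ^ j.val

theorem cast_prime_ne_zero : (d : ℂ) ≠ 0 := Nat.cast_ne_zero.2 (Fact.out : d.Prime).ne_zero

theorem sum_stdAddChar_mul (b : ZMod d) :
    ∑ x : ZMod d, (ZMod.stdAddChar (b * x) : ℂ) = if b = 0 then (d : ℂ) else 0 := by
  have h := AddChar.sum_mulShift b (ZMod.isPrimitive_stdAddChar d)
  simp only [ZMod.card] at h
  simp_rw [mul_comm b, h]
  split_ifs <;> simp

theorem pow_val_add {B : Matrix I I ℂ} (hB : B ^ d = 1) (j k : ZMod d) :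
    B ^ (j + k).val = B ^ j.val * B ^ k.val := by
  rw [ZMod.val_add, ← pow_eq_pow_mod _ hB, pow_add]

theorem pow_val_one {B : Matrix I I ℂ} : B ^ (1 : ZMod d).val = B := by
  have : Fact (1 < d) := ⟨(Fact.out : d.Prime).one_lt⟩
  rw [ZMod.val_one, pow_one]

theorem pow_mul_eigen {B : Matrix I I ℂ} {M : Matrix I α ℂ} {c : ℂ} (h : B * M = c • M) (j : ℕ) :
    B ^ j * M = c ^ j • M := by
  induction j with
  | zero => simp
  | succ j ih => rw [pow_succ, Matrix.mul_assoc, h, Matrix.mul_smul, ih, smul_smul, pow_succ']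

theorem stdAddChar_pow_val (y j : ZMod d) :
    (ZMod.stdAddChar y : ℂ) ^ j.val = ZMod.stdAddChar (y * j) := by
  rw [← AddChar.map_nsmul_eq_pow, nsmul_eq_mul, ZMod.natCast_zmod_val, mul_comm]

/-- Orthogonality of characters. `M` is rectangular so that the same statement serves projections,
isometries and single columns. -/
theorem spectralProj_mul_of_eigen {B : Matrix I I ℂ} {M : Matrix I α ℂ} {y : ZMod d}
    (h : B * M = (ZMod.stdAddChar y : ℂ) • M) (x : ZMod d) :
    spectralProj B x * M = if x = y then M else 0 := by
  have h1 : ∀ j : ZMod d, ((ZMod.stdAddChar (-(x * j)) : ℂ) • B ^ j.val) * M =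
      (ZMod.stdAddChar ((y - x) * j) : ℂ) • M := by
    intro j
    rw [Matrix.smul_mul, pow_mul_eigen h, smul_smul, stdAddChar_pow_val, ← AddChar.map_add_eq_mul]
    congr 2
    ring
  rw [spectralProj, Matrix.smul_mul, Matrix.sum_mul, Finset.sum_congr rfl fun j _ => h1 j,
    ← Finset.sum_smul, sum_stdAddChar_mul, smul_smul]
  by_cases hxy : x = y
  · rw [if_pos (sub_eq_zero.2 hxy.symm), if_pos hxy, inv_mul_cancel₀ cast_prime_ne_zero, one_smul]
  · rw [if_neg (fun h => hxy (sub_eq_zero.1 h).symm), if_neg hxy, mul_zero, zero_smul]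

theorem mul_spectralProj {B : Matrix I I ℂ} (hB : B ^ d = 1) (x : ZMod d) :
    B * spectralProj B x = (ZMod.stdAddChar x : ℂ) • spectralProj B x := by
  have key : ∑ j : ZMod d, B * ((ZMod.stdAddChar (-(x * j)) : ℂ) • B ^ j.val) =
      (ZMod.stdAddChar x : ℂ) • ∑ j : ZMod d, (ZMod.stdAddChar (-(x * j)) : ℂ) • B ^ j.val := by
    rw [Finset.smul_sum]
    refine Fintype.sum_equiv (Equiv.addRight (1 : ZMod d)) _ _ fun j => ?_
    rw [Matrix.mul_smul, Equiv.coe_addRight, smul_smul, ← AddChar.map_add_eq_mul, pow_val_add hB,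
      pow_val_one, ← pow_succ', pow_succ]
    congr 2
    ring
  rw [spectralProj, Matrix.mul_smul, Matrix.mul_sum, key, smul_comm]

theorem spectralProj_mul_spectralProj {B : Matrix I I ℂ} (hB : B ^ d = 1) (x y : ZMod d) :
    spectralProj B x * spectralProj B y = if x = y then spectralProj B y else 0 :=
  spectralProj_mul_of_eigen (mul_spectralProj hB y) x

theorem sum_spectralProj (B : Matrix I I ℂ) : ∑ x : ZMod d, spectralProj B x = 1 := by
  have h : ∀ j : ZMod d, ∑ x : ZMod d, (ZMod.stdAddChar (-(x * j)) : ℂ) =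
      if j = 0 then (d : ℂ) else 0 := by
    intro j
    have := sum_stdAddChar_mul (-j)
    simp only [neg_eq_zero] at this
    rw [← this]
    exact Finset.sum_congr rfl fun x _ => by rw [neg_mul, mul_comm]
  simp only [spectralProj]
  rw [← Finset.smul_sum, Finset.sum_comm]
  simp_rw [← Finset.sum_smul, h, ite_smul, zero_smul]
  rw [Finset.sum_ite_eq' Finset.univ, if_pos (Finset.mem_univ _), smul_smul,
    inv_mul_cancel₀ cast_prime_ne_zero, one_smul, ZMod.val_zero, pow_zero]

theorem mul_pow_of_comm {R : Type*} [Ring R] [Algebra ℂ R] {A B : R} {k : ZMod d}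
    (h : A * B = (ZMod.stdAddChar k : ℂ) • (B * A)) (j : ℕ) :
    A * B ^ j = (ZMod.stdAddChar k : ℂ) ^ j • (B ^ j * A) := by
  induction j with
  | zero => simp
  | succ j ih =>
    rw [pow_succ, ← mul_assoc, ih, smul_mul_assoc, mul_assoc, h, mul_smul_comm, smul_smul,
      ← pow_succ, mul_assoc]

theorem pow_mul_of_comm {R : Type*} [Ring R] [Algebra ℂ R] {A B : R} {k : ZMod d}
    (h : A * B = (ZMod.stdAddChar k : ℂ) • (B * A)) (j : ℕ) :
    A ^ j * B = (ZMod.stdAddChar k : ℂ) ^ j • (B * A ^ j) := by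
  induction j with
  | zero => simp
  | succ j ih =>
    rw [pow_succ', mul_assoc, ih, mul_smul_comm, ← mul_assoc, h, smul_mul_assoc, smul_smul,
      ← pow_succ, mul_assoc]

/-- `A` maps the `ω ^ x`-eigenspace of `B` into the `ω ^ (x - k)`-eigenspace. -/
theorem mul_spectralProj_of_comm {A B : Matrix I I ℂ} {k : ZMod d}
    (h : A * B = (ZMod.stdAddChar k : ℂ) • (B * A)) (x : ZMod d) :
    A * spectralProj B x = spectralProj B (x - k) * A := by
  rw [spectralProj, spectralProj, Matrix.mul_smul, Matrix.smul_mul, Matrix.mul_sum,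
    Matrix.sum_mul]
  congr 1
  refine Finset.sum_congr rfl fun j _ => ?_
  rw [Matrix.mul_smul, Matrix.smul_mul, mul_pow_of_comm h, smul_smul, stdAddChar_pow_val,
    ← AddChar.map_add_eq_mul]
  congr 2
  ring

theorem commute_spectralProj {A B : Matrix I I ℂ} (h : Commute A B) (x : ZMod d) :
    Commute A (spectralProj B x) :=
  (Commute.sum_right _ _ _ fun _ _ => (h.pow_right _).smul_right _).smul_right _

/-- Transport of spectral projections along an intertwiner. -/
theorem spectralProj_mul_intertwine {K : Type*} [Fintype K] [DecidableEq K] {B : Matrix I I ℂ}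
    {C : Matrix K K ℂ} {M : Matrix I K ℂ} {c : ZMod d}
    (h : B * M = (ZMod.stdAddChar c : ℂ) • (M * C)) (x : ZMod d) :
    spectralProj B x * M = M * spectralProj C (x - c) := by
  have hp : ∀ j : ℕ, B ^ j * M = (ZMod.stdAddChar c : ℂ) ^ j • (M * C ^ j) := by
    intro j
    induction j with
    | zero => simp
    | succ j ih =>
      rw [pow_succ', Matrix.mul_assoc, ih, Matrix.mul_smul, ← Matrix.mul_assoc, h,
        Matrix.smul_mul, smul_smul, ← pow_succ, Matrix.mul_assoc,
        ← pow_succ']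
  rw [spectralProj, spectralProj, Matrix.mul_smul, Matrix.smul_mul, Matrix.mul_sum,
    Matrix.sum_mul]
  congr 1
  refine Finset.sum_congr rfl fun j _ => ?_
  rw [Matrix.mul_smul, Matrix.smul_mul, hp, smul_smul, stdAddChar_pow_val,
    ← AddChar.map_add_eq_mul]
  congr 2
  ring

theorem pow_val_neg_mul {B : Matrix I I ℂ} (hB : B ^ d = 1) (j : ZMod d) :
    B ^ (-j).val * B ^ j.val = 1 := by
  rw [← pow_val_add hB, neg_add_cancel, ZMod.val_zero, pow_zero]

theorem star_pow_val {B : Matrix I I ℂ} (hB : B ^ d = 1) (hu : B ∈ Matrix.unitaryGroup I ℂ)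
    (j : ZMod d) : star (B ^ j.val) = B ^ (-j).val := by
  have h1 : star (B ^ j.val) * B ^ j.val = 1 := (pow_mem hu j.val).1
  have h2 := mul_eq_one_comm.1 (pow_val_neg_mul hB j)
  exact left_inv_eq_right_inv h1 h2

theorem isStarProjection_spectralProj {B : Matrix I I ℂ} (hB : B ^ d = 1)
    (hu : B ∈ Matrix.unitaryGroup I ℂ) (x : ZMod d) : IsStarProjection (spectralProj B x) := by
  refine ⟨by rw [IsIdempotentElem, spectralProj_mul_spectralProj hB, if_pos rfl], ?_⟩
  have h : ∀ y : ZMod d, (starRingEnd ℂ) (ZMod.stdAddChar y : ℂ) = ZMod.stdAddChar (-y) := by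
    intro y
    rw [AddChar.map_neg_eq_conj]
  rw [IsSelfAdjoint, spectralProj, star_smul, star_sum]
  congr 1
  · simp
  · refine Fintype.sum_equiv (Equiv.neg _) _ _ fun j => ?_
    rw [star_smul, Complex.star_def, h, star_pow_val hB hu, Equiv.neg_apply]
    congr 2
    ring

end SpectralProjections

/-! ### The Fourier transform of a conjugate pair. -/

section Fourier

variable {d : ℕ} [Fact d.Prime] {I : Type*} [Fintype I] [DecidableEq I] {α : Type*}

/-- The Fourier transform `√d ∑ k, P_k Q_0 B^{-k}` of a conjugate pair `A`, `B`, where `P_k` and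
`Q_k` are the spectral projections of `B` and `A`. -/
def pairFourier (d : ℕ) [Fact d.Prime] (A B : Matrix I I ℂ) : Matrix I I ℂ :=
  (Real.sqrt d : ℂ) • ∑ k : ZMod d,
    spectralProj B k * spectralProj A (0 : ZMod d) * B ^ (-k).val

variable {A B : Matrix I I ℂ}

theorem comm_symm {R : Type*} [Ring R] [Algebra ℂ R] {A B : R} {k : ZMod d}
    (h : A * B = (ZMod.stdAddChar k : ℂ) • (B * A)) :
    B * A = (ZMod.stdAddChar (-k) : ℂ) • (A * B) := by
  rw [h, smul_smul, ← AddChar.map_add_eq_mul, neg_add_cancel, AddChar.map_zero_eq_one, one_smul]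

/-- Expand the middle projection in powers `B ^ j`. Each `B ^ j` shifts the eigenspaces of `A` by
`j`, so only `j = 0`, with coefficient `1 / d`, survives between two copies of the same projection.
-/
theorem spectralProj_sandwich (hA : A ^ d = 1)
    (h : A * B = (ZMod.stdAddChar (1 : ZMod d) : ℂ) • (B * A)) (k : ZMod d) :
    spectralProj A (0 : ZMod d) * spectralProj B k * spectralProj A (0 : ZMod d) =
      (d : ℂ)⁻¹ • spectralProj A (0 : ZMod d) := by
  have h1 : ∀ j : ZMod d, B ^ j.val * A = (ZMod.stdAddChar (-j) : ℂ) • (A * B ^ j.val) := by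
    intro j
    rw [pow_mul_of_comm (comm_symm h), stdAddChar_pow_val, neg_mul, one_mul]
  have h2 : ∀ j : ZMod d, spectralProj A (0 : ZMod d) * B ^ j.val * spectralProj A (0 : ZMod d) =
      if j = 0 then spectralProj A (0 : ZMod d) else 0 := by
    intro j
    rw [mul_assoc, mul_spectralProj_of_comm (h1 j), ← mul_assoc,
      spectralProj_mul_spectralProj hA]
    by_cases hj : j = 0
    · subst hj
      rw [if_pos (by simp), if_pos rfl, ZMod.val_zero, pow_zero, mul_one, neg_zero, sub_zero]
    · rw [if_neg (by simpa using fun h => hj h.symm), if_neg hj, zero_mul]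
  rw [spectralProj.eq_def B k, Matrix.mul_smul, Matrix.smul_mul, Matrix.mul_sum, Matrix.sum_mul]
  congr 1
  rw [Finset.sum_eq_single (0 : ZMod d)]
  · rw [Matrix.mul_smul, Matrix.smul_mul, h2, if_pos rfl, mul_zero, neg_zero,
      AddChar.map_zero_eq_one, one_smul]
  · intro j _ hj
    rw [Matrix.mul_smul, Matrix.smul_mul, h2, if_neg hj, smul_zero]
  · simp

theorem sqrt_mul_sqrt_natCast (d : ℕ) : (Real.sqrt d : ℂ) * Real.sqrt d = d := by
  rw [← Complex.ofReal_mul, Real.mul_self_sqrt (Nat.cast_nonneg d), Complex.ofReal_natCast]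

theorem pairFourier_mem_unitaryGroup (hA : A ^ d = 1) (hB : B ^ d = 1)
    (hAu : A ∈ Matrix.unitaryGroup I ℂ) (hBu : B ∈ Matrix.unitaryGroup I ℂ)
    (h : A * B = (ZMod.stdAddChar (1 : ZMod d) : ℂ) • (B * A)) :
    pairFourier d A B ∈ Matrix.unitaryGroup I ℂ := by
  rw [Matrix.mem_unitaryGroup_iff', pairFourier, star_smul, star_sum, smul_mul_smul_comm,
    Finset.sum_mul_sum, Complex.star_def, Complex.conj_ofReal, sqrt_mul_sqrt_natCast]
  have hQ := isStarProjection_spectralProj hA hAu (0 : ZMod d)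
  -- Cross terms vanish through `P_k P_l = 0`. On the diagonal the sandwich leaves `Q_0 / d`, which
  -- conjugation by `B ^ k` turns into `Q_k / d`. The `Q_k` sum to `1`.
  have h1 : ∀ k l : ZMod d, star (spectralProj B k * spectralProj A (0 : ZMod d) *
      B ^ (-k).val) * (spectralProj B l * spectralProj A (0 : ZMod d) * B ^ (-l).val) =
      if k = l then (d : ℂ)⁻¹ • spectralProj A k else 0 := by
    intro k l
    have hP := isStarProjection_spectralProj hB hBu k
    have hBA : B ^ k.val * A = (ZMod.stdAddChar (-k) : ℂ) • (A * B ^ k.val) := by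
      rw [pow_mul_of_comm (comm_symm h), stdAddChar_pow_val, neg_mul, one_mul]
    rw [star_mul, star_mul, star_pow_val hB hBu, hP.isSelfAdjoint.star_eq,
      hQ.isSelfAdjoint.star_eq, neg_neg]
    calc _ = B ^ k.val * (spectralProj A (0 : ZMod d) * (spectralProj B k * spectralProj B l) *
          spectralProj A (0 : ZMod d)) * B ^ (-l).val := by simp only [mul_assoc]
      _ = _ := by
        rw [spectralProj_mul_spectralProj hB]
        split_ifs with hkl
        · subst hkl
          rw [spectralProj_sandwich hA h, Matrix.mul_smul, Matrix.smul_mul,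
            mul_spectralProj_of_comm hBA, mul_assoc, ← pow_val_add hB, add_neg_cancel,
            ZMod.val_zero, pow_zero, mul_one, zero_sub, neg_neg]
        · simp
  simp_rw [h1]
  simp only [Finset.sum_ite_eq, Finset.mem_univ, if_true]
  rw [← Finset.smul_sum, sum_spectralProj, smul_smul, mul_inv_cancel₀ cast_prime_ne_zero,
    one_smul]

/-- With `V` the transform, this amounts to `V B V⁻¹ = A⁻¹`. On the left `A` turns `P_k` into
`P_{k-1}` and is absorbed by `Q_0`; on the right `B` turns `B^{-k}` into `B^{-(k-1)}`; so the sum is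
only reindexed. -/
theorem mul_pairFourier_mul (hA : A ^ d = 1) (hB : B ^ d = 1)
    (h : A * B = (ZMod.stdAddChar (1 : ZMod d) : ℂ) • (B * A)) :
    A * pairFourier d A B * B = pairFourier d A B := by
  rw [pairFourier, Matrix.mul_smul, Matrix.smul_mul, Matrix.mul_sum, Matrix.sum_mul]
  congr 1
  refine Fintype.sum_equiv (Equiv.subRight 1) _ _ fun k => ?_
  have h1 : (-(k - 1)) = -k + 1 := by ring
  have h2 := mul_spectralProj hA (0 : ZMod d)
  rw [AddChar.map_zero_eq_one, one_smul] at h2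
  rw [Equiv.subRight_apply, h1, pow_val_add hB, pow_val_one, ← mul_assoc, ← mul_assoc,
    ← mul_assoc, mul_spectralProj_of_comm h, mul_assoc (spectralProj B (k - 1)) A, h2]

/-- This amounts to `V A V⁻¹ = B`. Moving `A` left past `B^{-k}` produces `ω ^ k`, which is the
eigenvalue of `B` on `P_k`. -/
theorem pairFourier_mul (hA : A ^ d = 1) (hB : B ^ d = 1)
    (h : A * B = (ZMod.stdAddChar (1 : ZMod d) : ℂ) • (B * A)) :
    pairFourier d A B * A = B * pairFourier d A B := by
  rw [pairFourier, Matrix.mul_smul, Matrix.smul_mul, Matrix.mul_sum, Matrix.sum_mul]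
  congr 1
  refine Finset.sum_congr rfl fun k _ => ?_
  have h2 : spectralProj A (0 : ZMod d) * A = spectralProj A (0 : ZMod d) := by
    have h3 := mul_spectralProj hA (0 : ZMod d)
    rw [AddChar.map_zero_eq_one, one_smul] at h3
    rw [← (commute_spectralProj (Commute.refl A) (0 : ZMod d)).eq, h3]
  have h4 : B ^ (-k).val * A = (ZMod.stdAddChar k : ℂ) • (A * B ^ (-k).val) := by
    rw [pow_mul_of_comm (comm_symm h), stdAddChar_pow_val, neg_mul_neg, one_mul]
  rw [mul_assoc, h4, Matrix.mul_smul, ← mul_assoc, mul_assoc (spectralProj B k), h2, ← mul_assoc,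
    ← mul_assoc, mul_spectralProj hB, Matrix.smul_mul, Matrix.smul_mul]

/-- If `A` fixes `M`, then `B^{-k} M` lies in the `ω^{-k}`-eigenspace of `A`, so `Q_0` kills every
term of the transform except `k = 0`. On `M` the projection `P_0` is therefore a multiple of a
unitary. -/
theorem pairFourier_mul_of_fixed
    (h : A * B = (ZMod.stdAddChar (1 : ZMod d) : ℂ) • (B * A)) {M : Matrix I α ℂ}
    (hM : A * M = M) :
    spectralProj B (0 : ZMod d) * M = (Real.sqrt d : ℂ)⁻¹ • (pairFourier d A B * M) := by
  have h0 : (Real.sqrt d : ℂ) ≠ 0 := by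
    intro h0
    have := sqrt_mul_sqrt_natCast d
    rw [h0, zero_mul] at this
    exact cast_prime_ne_zero this.symm
  rw [pairFourier, Matrix.smul_mul, smul_smul, inv_mul_cancel₀ h0, one_smul, Matrix.sum_mul,
    Finset.sum_eq_single (0 : ZMod d)]
  · rw [neg_zero, ZMod.val_zero, pow_zero, mul_one, Matrix.mul_assoc,
      spectralProj_mul_of_eigen (B := A) (y := (0 : ZMod d)) (by rw [AddChar.map_zero_eq_one, one_smul, hM]),
      if_pos rfl]
  · intro k _ hk
    have h1 : A * (B ^ (-k).val * M) = (ZMod.stdAddChar (-k) : ℂ) • (B ^ (-k).val * M) := by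
      rw [← Matrix.mul_assoc, mul_pow_of_comm h, stdAddChar_pow_val, one_mul, Matrix.smul_mul,
        Matrix.mul_assoc, hM]
    rw [Matrix.mul_assoc, Matrix.mul_assoc, spectralProj_mul_of_eigen h1, if_neg, Matrix.mul_zero]
    simpa using hk
  · simp

end Fourier

/-! ### Pauli measurements with random outcome as Clifford unitaries. -/

section FourierClifford

variable {d n : ℕ} [Fact d.Prime]

theorem mem_cliffordGroup_of_conj {U : QUnitary d n}
    (h₁ : ∀ a, U * weylUnitary a * U⁻¹ ∈ pauliGroup d n)
    (h₂ : ∀ a, U⁻¹ * weylUnitary a * U ∈ pauliGroup d n) : U ∈ cliffordGroup d n := by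
  have key : ∀ V : QUnitary d n, (∀ a, V * weylUnitary a * V⁻¹ ∈ pauliGroup d n) →
      ∀ g ∈ pauliGroup d n, V * g * V⁻¹ ∈ pauliGroup d n := by
    intro V hV g hg
    have h : pauliGroup d n ≤ (pauliGroup d n).comap (MulAut.conj V).toMonoidHom := by
      rw [pauliGroup, Subgroup.closure_le]
      rintro _ ⟨a, rfl⟩
      exact hV a
    exact h hg
  rw [cliffordGroup, Subgroup.mem_normalizer_iff]
  refine fun g => ⟨key U h₁ g, fun hg => ?_⟩
  have h := key U⁻¹ (by simpa using h₂) _ hg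
  simpa [mul_assoc] using h

theorem conj_mem_pauliGroup {U : QUnitary d n} (hU : U ∈ cliffordGroup d n) {g : QUnitary d n}
    (hg : g ∈ pauliGroup d n) : U * g * U⁻¹ ∈ pauliGroup d n :=
  (Subgroup.mem_normalizer_iff.1 hU g).1 hg

theorem conj_mem_pauliGroup' {U : QUnitary d n} (hU : U ∈ cliffordGroup d n) {g : QUnitary d n}
    (hg : g ∈ pauliGroup d n) : U⁻¹ * g * U ∈ pauliGroup d n :=
  (Subgroup.mem_normalizer_iff''.1 hU g).1 hg

/-- The Fourier transform of a conjugate pair of Pauli operators is Clifford. -/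
theorem pairFourier_mem_cliffordGroup {A B : QUnitary d n} (hAP : A ∈ pauliGroup d n)
    (hBP : B ∈ pauliGroup d n) (hA : (A : QOp d n) ^ d = 1) (hB : (B : QOp d n) ^ d = 1)
    (h : (A : QOp d n) * B = (ZMod.stdAddChar (1 : ZMod d) : ℂ) • ((B : QOp d n) * A)) :
    (⟨pairFourier d (A : QOp d n) (B : QOp d n),
      pairFourier_mem_unitaryGroup hA hB A.2 B.2 h⟩ : QUnitary d n) ∈ cliffordGroup d n := by
  set V : QUnitary d n := ⟨pairFourier d (A : QOp d n) (B : QOp d n),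
    pairFourier_mem_unitaryGroup hA hB A.2 B.2 h⟩ with hV
  have hVA : V * A = B * V := Subtype.ext (pairFourier_mul hA hB h)
  have hVB : A * V * B = V := Subtype.ext (mul_pairFourier_mul hA hB h)
  -- Symplectic elimination: multiplying `C` by suitable powers of `A` and `B` cancels its
  -- commutation phases `p` and `q` with them. The remaining factor `D` commutes with both, hence
  -- with the transform.
  have split : ∀ C ∈ pauliGroup d n, ∃ i j : ℕ, ∃ D ∈ pauliGroup d n,
      C = (A ^ i * B ^ j)⁻¹ * D ∧ D * V = V * D := by
    intro C hC
    obtain ⟨p, hp⟩ := exists_commutation hC hAP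
    obtain ⟨q, hq⟩ := exists_commutation hC hBP
    refine ⟨(-q).val, p.val, A ^ (-q).val * B ^ p.val * C,
      mul_mem (mul_mem (pow_mem hAP _) (pow_mem hBP _)) hC, by group, ?_⟩
    set D : QOp d n := (A : QOp d n) ^ (-q).val * (B : QOp d n) ^ p.val * C with hD
    have hDA : Commute D (A : QOp d n) := by
      have h1 : (B : QOp d n) ^ p.val * A = (ZMod.stdAddChar (-p) : ℂ) •
          ((A : QOp d n) * (B : QOp d n) ^ p.val) := by
        rw [pow_mul_of_comm (comm_symm h), stdAddChar_pow_val, neg_mul, one_mul]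
      calc D * A = (A : QOp d n) ^ (-q).val * (B : QOp d n) ^ p.val * (C * A) := by
            rw [hD, mul_assoc]
        _ = (ZMod.stdAddChar p : ℂ) • ((A : QOp d n) ^ (-q).val * ((B : QOp d n) ^ p.val * A) * C)
            := by rw [hp, mul_smul_comm]; simp only [mul_assoc]
        _ = (A : QOp d n) ^ (-q).val * (A * (B : QOp d n) ^ p.val) * C := by
            rw [h1, mul_smul_comm, smul_mul_assoc, smul_smul, ← AddChar.map_add_eq_mul,
              add_neg_cancel, AddChar.map_zero_eq_one, one_smul]
        _ = A * D := by
            rw [hD, ← mul_assoc, ← pow_succ, pow_succ']; simp only [mul_assoc]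
    have hDB : Commute D (B : QOp d n) := by
      have h1 : (A : QOp d n) ^ (-q).val * B = (ZMod.stdAddChar (-q) : ℂ) •
          ((B : QOp d n) * (A : QOp d n) ^ (-q).val) := by
        rw [pow_mul_of_comm h, stdAddChar_pow_val, one_mul]
      calc D * B = (A : QOp d n) ^ (-q).val * (B : QOp d n) ^ p.val * (C * B) := by
            rw [hD, mul_assoc]
        _ = (ZMod.stdAddChar q : ℂ) • ((A : QOp d n) ^ (-q).val * ((B : QOp d n) ^ p.val * B) * C)
            := by rw [hq, mul_smul_comm]; simp only [mul_assoc]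
        _ = (ZMod.stdAddChar q : ℂ) • ((A : QOp d n) ^ (-q).val * B * (B : QOp d n) ^ p.val * C)
            := by rw [← pow_succ, pow_succ']; simp only [mul_assoc]
        _ = B * D := by
            rw [h1, hD, smul_mul_assoc, smul_mul_assoc, smul_smul, ← AddChar.map_add_eq_mul,
              add_neg_cancel, AddChar.map_zero_eq_one, one_smul]
            simp only [mul_assoc]
    apply Subtype.ext
    have hDV : Commute D (pairFourier d (A : QOp d n) (B : QOp d n)) :=
      (Commute.sum_right _ _ _ fun k _ => ((commute_spectralProj hDB k).mul_right
        (commute_spectralProj hDA 0)).mul_right (hDB.pow_right _)).smul_right _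
    exact hDV
  have cA : V * A * V⁻¹ = B := by rw [hVA, mul_inv_cancel_right]
  have cB : V * B * V⁻¹ = A⁻¹ := by
    rw [mul_inv_eq_iff_eq_mul, eq_inv_mul_iff_mul_eq, ← mul_assoc]; exact hVB
  have cA' : V⁻¹ * A * V = B⁻¹ := by
    rw [eq_inv_iff_mul_eq_one, mul_assoc, mul_assoc, ← mul_assoc A, hVB, inv_mul_cancel]
  have cB' : V⁻¹ * B * V = A := by rw [mul_assoc, ← hVA, inv_mul_cancel_left]
  refine mem_cliffordGroup_of_conj (fun a => ?_) (fun a => ?_)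
  · obtain ⟨i, j, D, hD, hC, hDV⟩ := split _ (weylUnitary_mem a)
    have e : V * weylUnitary a * V⁻¹ =
        ((V * A * V⁻¹) ^ i * (V * B * V⁻¹) ^ j)⁻¹ * D := by
      rw [hC, conj_pow, conj_pow]
      have : D = V * D * V⁻¹ := by rw [← hDV, mul_inv_cancel_right]
      conv_rhs => rw [this]
      group
    rw [e, cA, cB]
    exact mul_mem (inv_mem (mul_mem (pow_mem hBP _) (pow_mem (inv_mem hAP) _))) hD
  · obtain ⟨i, j, D, hD, hC, hDV⟩ := split _ (weylUnitary_mem a)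
    have e : V⁻¹ * weylUnitary a * V =
        ((V⁻¹ * A * V) ^ i * (V⁻¹ * B * V) ^ j)⁻¹ * D := by
      have hp : ∀ (X : QUnitary d n) (i : ℕ), (V⁻¹ * X * V) ^ i = V⁻¹ * X ^ i * V := by
        intro X i
        have := conj_pow (i := i) (a := V⁻¹) (b := X)
        rwa [inv_inv] at this
      rw [hC, hp, hp]
      have : D = V⁻¹ * D * V := by rw [mul_assoc, hDV, inv_mul_cancel_left]
      conv_rhs => rw [this]
      group
    rw [e, cA', cB']
    exact mul_mem (inv_mem (mul_mem (pow_mem (inv_mem hBP) _) (pow_mem hAP _))) hD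

/-- A Pauli measurement with a uniformly random outcome acts as a Clifford unitary. -/
theorem exists_clifford_of_noncomm {α : Type*} {M : Matrix (Fin n → ZMod d) α ℂ} (hM : M ≠ 0)
    {A B : QUnitary d n} (hAP : A ∈ pauliGroup d n) (hBP : B ∈ pauliGroup d n)
    (hB : (B : QOp d n) ^ d = 1) (hAM : (A : QOp d n) * M = M)
    (hAB : (A : QOp d n) * B ≠ B * A) (x : ZMod d) :
    ∃ V ∈ cliffordGroup d n,
      spectralProj (B : QOp d n) x * M = (Real.sqrt d : ℂ)⁻¹ • ((V : QOp d n) * M) := by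
  obtain ⟨k, hk⟩ := exists_commutation hAP hBP
  have hk0 : k ≠ 0 := by
    rintro rfl
    rw [AddChar.map_zero_eq_one, one_smul] at hk
    exact hAB hk
  -- The `d`-th power of a phased Pauli operator is a scalar, and here it fixes the nonzero `M`.
  have hAd : (A : QOp d n) ^ d = 1 := by
    obtain ⟨c, a, -, hA⟩ := exists_eq_smul_shiftClock hAP
    have hz : d • a = 0 := by ext i <;> simp
    have h1 : (A : QOp d n) ^ d = (c ^ d * ZMod.stdAddChar (-((d.choose 2 : ZMod d) *
        (a.1 ⬝ᵥ a.2)))) • (1 : QOp d n) := by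
      rw [hA, smul_pow, shiftClock_pow, hz, shiftClock_zero, smul_smul]
    have h2 := pow_mul_eigen (c := 1) (by rwa [one_smul]) d (B := (A : QOp d n)) (M := M)
    rw [one_pow, h1, Matrix.smul_mul, Matrix.one_mul] at h2
    rw [h1, smul_left_injective ℂ hM h2, one_smul]
  -- The exponent `k⁻¹` normalises the commutation phase from `ω ^ k` to `ω`. Below, the factor
  -- `ω^{-x}` in `B'` moves the outcome `x` to the outcome `0`.
  set A' : QUnitary d n := A ^ (k⁻¹).val with hA'
  have hAc : (A' : QOp d n) = (A : QOp d n) ^ (k⁻¹).val := rfl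
  have hA'B : (A' : QOp d n) * B = (ZMod.stdAddChar (1 : ZMod d) : ℂ) • ((B : QOp d n) * A') := by
    rw [hAc, pow_mul_of_comm hk, stdAddChar_pow_val, mul_inv_cancel₀ hk0]
  have hA'P : A' ∈ pauliGroup d n := pow_mem hAP _
  set B' : QUnitary d n := phaseUnitary n (-x) * B with hB'
  have hBc : (B' : QOp d n) = (ZMod.stdAddChar (-x) : ℂ) • (B : QOp d n) := by
    rw [hB', Submonoid.coe_mul, coe_phaseUnitary, smul_mul_assoc, one_mul]
  have hB'P : B' ∈ pauliGroup d n := mul_mem (phaseUnitary_mem hAP hBP hk0 hk _) hBP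
  have hB'd : (B' : QOp d n) ^ d = 1 := by
    rw [hBc, smul_pow, hB, ← AddChar.map_nsmul_eq_pow]
    simp
  have hA'd : (A' : QOp d n) ^ d = 1 := by
    rw [hAc, ← pow_mul, mul_comm, pow_mul, hAd, one_pow]
  have hA'B' : (A' : QOp d n) * B' =
      (ZMod.stdAddChar (1 : ZMod d) : ℂ) • ((B' : QOp d n) * A') := by
    rw [hBc, mul_smul_comm, hA'B, smul_comm, smul_mul_assoc]
  have hA'M : (A' : QOp d n) * M = M := by
    rw [hAc, pow_mul_eigen (c := 1) (by rwa [one_smul]), one_pow, one_smul]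
  refine ⟨_, pairFourier_mem_cliffordGroup hA'P hB'P hA'd hB'd hA'B', ?_⟩
  have h0 : spectralProj (B' : QOp d n) (0 : ZMod d) = spectralProj (B : QOp d n) x := by
    have := spectralProj_mul_intertwine (B := (B' : QOp d n)) (C := (B : QOp d n)) (M := 1)
      (c := -x) (by rw [hBc, mul_one, one_mul]) 0
    rwa [mul_one, one_mul, zero_sub, neg_neg] at this
  rw [← h0]
  exact pairFourier_mul_of_fixed hA'B' hA'M

end FourierClifford

/-! ### Operators acting on a subset of the qudits. -/

section Extension

variable {d : ℕ} [Fact d.Prime] {k m n N : ℕ}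

omit [Fact d.Prime] in
theorem extend_comp (f : Fin m ↪ Fin N) (v : Fin m → ZMod d) (x : Fin N → ZMod d) :
    Function.extend f v x ∘ f = v :=
  Function.extend_comp f.injective v x

/-- The strings `x` and `y` agree outside the range of `f`. -/
def AgreeOff (f : Fin m ↪ Fin N) (x y : Fin N → ZMod d) : Prop :=
  ∀ i, i ∉ Set.range f → x i = y i

omit [Fact d.Prime] in
theorem agreeOff_extend (f : Fin m ↪ Fin N) (v : Fin m → ZMod d) (x : Fin N → ZMod d) :
    AgreeOff f x (Function.extend f v x) :=
  fun i hi => (Function.extend_apply' v x i hi).symm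

omit [Fact d.Prime] in
theorem extend_comp_of_agreeOff {f : Fin m ↪ Fin N} {x y : Fin N → ZMod d} (h : AgreeOff f x y) :
    Function.extend f (y ∘ f) x = y := by
  funext i
  by_cases hi : i ∈ Set.range f
  · obtain ⟨j, rfl⟩ := hi
    rw [f.injective.extend_apply, Function.comp_apply]
  · rw [Function.extend_apply' _ _ _ hi, h i hi]

omit [Fact d.Prime] in
theorem agreeOff_extend_left_iff (f : Fin m ↪ Fin N) (v : Fin m → ZMod d)
    (x y : Fin N → ZMod d) : AgreeOff f (Function.extend f v x) y ↔ AgreeOff f x y :=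
  forall₂_congr fun i hi => by rw [Function.extend_apply' v x i hi]

omit [Fact d.Prime] in
theorem eq_iff_agreeOff {f : Fin m ↪ Fin N} {x y : Fin N → ZMod d} :
    x = y ↔ AgreeOff f x y ∧ x ∘ f = y ∘ f := by
  refine ⟨by rintro rfl; exact ⟨fun _ _ => rfl, rfl⟩, fun ⟨h, h'⟩ => ?_⟩
  funext i
  by_cases hi : i ∈ Set.range f
  · obtain ⟨j, rfl⟩ := hi
    exact congrFun h' j
  · exact h i hi

open Classical in
theorem sum_agreeOff (f : Fin m ↪ Fin N) (x : Fin N → ZMod d) (F : (Fin N → ZMod d) → ℂ) :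
    (∑ w, if AgreeOff f x w then F w else 0) = ∑ v, F (Function.extend f v x) := by
  rw [← Finset.sum_filter]
  refine Finset.sum_nbij' (fun w => w ∘ f) (fun v => Function.extend f v x) ?_ ?_ ?_ ?_ ?_
  · simp
  · intro v _
    simpa using agreeOff_extend f v x
  · intro w hw
    exact extend_comp_of_agreeOff (Finset.mem_filter.1 hw).2
  · intro v _
    exact extend_comp f v x
  · intro w hw
    rw [extend_comp_of_agreeOff (Finset.mem_filter.1 hw).2]

open Classical in
/-- The operator on `N` qudits acting as `B` on the qudits in the range of `f` and trivially on the
others. -/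
def extendOp (f : Fin m ↪ Fin N) : QOp d m →ₐ[ℂ] QOp d N where
  toFun B := Matrix.of fun x y => if AgreeOff f x y then B (x ∘ f) (y ∘ f) else 0
  map_one' := by
    ext x y
    simp only [Matrix.of_apply, Matrix.one_apply, eq_iff_agreeOff (f := f) (x := x)]
    split_ifs <;> simp_all
  map_zero' := by ext; simp
  map_add' B C := by ext x y; simp only [Matrix.of_apply, Matrix.add_apply]; split_ifs <;> simp
  map_mul' B C := by
    ext x y
    simp only [Matrix.of_apply, Matrix.mul_apply, ite_mul, zero_mul]
    rw [sum_agreeOff f x]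
    simp only [agreeOff_extend_left_iff, extend_comp]
    split_ifs <;> simp
  commutes' c := by
    ext x y
    simp only [Matrix.of_apply, Matrix.algebraMap_matrix_apply,
      eq_iff_agreeOff (f := f) (x := x)]
    split_ifs <;> simp_all

open Classical in
theorem extendOp_apply (f : Fin m ↪ Fin N) (B : QOp d m) (x y : Fin N → ZMod d) :
    extendOp f B x y = if AgreeOff f x y then B (x ∘ f) (y ∘ f) else 0 := rfl

theorem extendOp_conjTranspose (f : Fin m ↪ Fin N) (B : QOp d m) :
    extendOp f Bᴴ = (extendOp f B)ᴴ := by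
  ext x y
  have h : AgreeOff f x y ↔ AgreeOff f y x := forall₂_congr fun _ _ => eq_comm
  rw [Matrix.conjTranspose_apply, extendOp_apply, extendOp_apply]
  by_cases hxy : AgreeOff f x y
  · rw [if_pos hxy, if_pos (h.1 hxy), Matrix.conjTranspose_apply]
  · rw [if_neg hxy, if_neg (mt h.2 hxy), star_zero]

theorem extendOp_trans (f : Fin m ↪ Fin n) (g : Fin n ↪ Fin N) (B : QOp d m) :
    extendOp (f.trans g) B = extendOp g (extendOp f B) := by
  ext x y
  have h : AgreeOff (f.trans g) x y ↔ AgreeOff g x y ∧ AgreeOff f (x ∘ g) (y ∘ g) := by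
    constructor
    · refine fun h => ⟨fun i hi => h i ?_, fun i hi => h (g i) ?_⟩
      · rintro ⟨j, rfl⟩
        exact hi ⟨f j, rfl⟩
      · rintro ⟨j, hj⟩
        exact hi ⟨j, g.injective hj⟩
    · rintro ⟨h₁, h₂⟩ i hi
      by_cases hg : i ∈ Set.range g
      · obtain ⟨j, rfl⟩ := hg
        refine h₂ j ?_
        rintro ⟨k, rfl⟩
        exact hi ⟨k, rfl⟩
      · exact h₁ i hg
  rw [extendOp_apply, extendOp_apply, extendOp_apply]
  by_cases h₁ : AgreeOff g x y
  · by_cases h₂ : AgreeOff f (x ∘ g) (y ∘ g)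
    · rw [if_pos (h.2 ⟨h₁, h₂⟩), if_pos h₁, if_pos h₂]; rfl
    · rw [if_neg (fun hn => h₂ (h.1 hn).2), if_pos h₁, if_neg h₂]
  · rw [if_neg (fun hn => h₁ (h.1 hn).1), if_neg h₁]

/-- Extension of unitaries to a larger register. -/
def extendUnitary (f : Fin m ↪ Fin N) (U : QUnitary d m) : QUnitary d N :=
  ⟨extendOp f U, by
    rw [Matrix.mem_unitaryGroup_iff, Matrix.star_eq_conjTranspose, ← extendOp_conjTranspose,
      ← map_mul, ← Matrix.star_eq_conjTranspose, U.2.2, map_one]⟩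

theorem coe_extendUnitary (f : Fin m ↪ Fin N) (U : QUnitary d m) :
    (extendUnitary f U : QOp d N) = extendOp f U := rfl

theorem extendUnitary_mul (f : Fin m ↪ Fin N) (U V : QUnitary d m) :
    extendUnitary f (U * V) = extendUnitary f U * extendUnitary f V :=
  Subtype.ext (map_mul (extendOp f) _ _)

theorem extendUnitary_inv (f : Fin m ↪ Fin N) (U : QUnitary d m) :
    extendUnitary f U⁻¹ = (extendUnitary f U)⁻¹ := by
  rw [eq_inv_iff_mul_eq_one, ← extendUnitary_mul, inv_mul_cancel]
  exact Subtype.ext (map_one (extendOp f))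

theorem extendOp_spectralProj (f : Fin m ↪ Fin N) (B : QOp d m) (x : ZMod d) :
    extendOp f (spectralProj B x) = spectralProj (extendOp f B) x := by
  simp only [spectralProj, map_smul, map_sum, map_pow]

/-- The Pauli index of an extended Pauli operator. -/
def extendIndex (f : Fin m ↪ Fin N) (a : PauliIndex d m) : PauliIndex d N :=
  (Function.extend f a.1 0, Function.extend f a.2 0)

theorem extend_dotProduct (f : Fin m ↪ Fin N) (v : Fin m → ZMod d) (x : Fin N → ZMod d) :
    Function.extend f v 0 ⬝ᵥ x = v ⬝ᵥ (x ∘ f) := by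
  symm
  refine Fintype.sum_of_injective f f.injective _ _ (fun i hi => ?_) (fun i => ?_)
  · rw [Function.extend_apply' _ _ _ hi]; simp
  · rw [f.injective.extend_apply]; rfl

theorem extendOp_shiftClock (f : Fin m ↪ Fin N) (a : PauliIndex d m) :
    extendOp f (shiftClock a) = shiftClock (extendIndex f a) := by
  ext x y
  have h : x = y + (extendIndex f a).2 ↔ AgreeOff f x y ∧ x ∘ f = y ∘ f + a.2 := by
    rw [eq_iff_agreeOff (f := f)]
    refine and_congr (forall₂_congr fun i hi => ?_) ?_
    · simp [extendIndex, Function.extend_apply' _ _ _ hi]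
    · rw [Pi.add_comp, extendIndex, extend_comp]
  rw [extendOp_apply, shiftClock_apply, shiftClock_apply]
  by_cases h₁ : AgreeOff f x y
  · by_cases h₂ : x ∘ f = y ∘ f + a.2
    · rw [if_pos (h.2 ⟨h₁, h₂⟩), if_pos h₁, if_pos h₂, extendIndex, extend_dotProduct]
    · rw [if_neg (fun hn => h₂ (h.1 hn).2), if_pos h₁, if_neg h₂]
  · rw [if_neg (fun hn => h₁ (h.1 hn).1), if_neg h₁]

theorem extendOp_weyl (f : Fin m ↪ Fin N) (a : PauliIndex d m) :
    extendOp f (weyl a) = weyl (extendIndex f a) := by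
  rw [weyl_eq_smul, weyl_eq_smul, map_smul, extendOp_shiftClock]
  congr 2
  refine Fintype.sum_of_injective f f.injective _ _ (fun i hi => ?_) (fun i => ?_)
  · simp [extendIndex, Function.extend_apply' _ _ _ hi]
  · simp [extendIndex, f.injective.extend_apply]

theorem extendUnitary_mem_pauliGroup (f : Fin m ↪ Fin N) {g : QUnitary d m}
    (hg : g ∈ pauliGroup d m) : extendUnitary f g ∈ pauliGroup d N := by
  induction hg using Subgroup.closure_induction with
  | mem x hx =>
    obtain ⟨a, rfl⟩ := hx
    have : extendUnitary f (weylUnitary a) = weylUnitary (extendIndex f a) :=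
      Subtype.ext (extendOp_weyl f a)
    rw [this]
    exact weylUnitary_mem _
  | one =>
    have : extendUnitary f (1 : QUnitary d m) = 1 := Subtype.ext (map_one (extendOp f))
    rw [this]
    exact one_mem _
  | mul x y _ _ hx hy => rw [extendUnitary_mul]; exact mul_mem hx hy
  | inv x _ hx => rw [extendUnitary_inv]; exact inv_mem hx

theorem shiftClock_commute_extendOp (f : Fin m ↪ Fin N) {a : PauliIndex d N}
    (h₁ : a.1 ∘ f = 0) (h₂ : a.2 ∘ f = 0) (B : QOp d m) :
    shiftClock a * extendOp f B = extendOp f B * shiftClock a := by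
  ext x y
  rw [shiftClock_mul_apply, mul_shiftClock_apply, extendOp_apply, extendOp_apply]
  have h : AgreeOff f (x - a.2) y ↔ AgreeOff f x (y + a.2) :=
    forall₂_congr fun i _ => sub_eq_iff_eq_add
  have hx : (x - a.2) ∘ f = x ∘ f := by rw [Pi.sub_comp, h₂, sub_zero]
  have hy : (y + a.2) ∘ f = y ∘ f := by rw [Pi.add_comp, h₂, add_zero]
  rw [hx, hy]
  by_cases hxy : AgreeOff f x (y + a.2)
  · rw [if_pos hxy, if_pos (h.2 hxy)]
    have e : a.1 ⬝ᵥ x = a.1 ⬝ᵥ (y + a.2) := by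
      refine Finset.sum_congr rfl fun i _ => ?_
      by_cases hi : i ∈ Set.range f
      · obtain ⟨j, rfl⟩ := hi
        rw [show a.1 (f j) = 0 from congrFun h₁ j, zero_mul, zero_mul]
      · rw [hxy i hi]
    rw [e, mul_comm]
  · rw [if_neg hxy, if_neg (mt h.1 hxy), mul_zero, zero_mul]

/-- A Pauli operator on the large register is an extended Pauli operator times one supported off the
range of `f`. The second factor commutes with everything extended along `f`, and its phase is
irrelevant, so it may be taken as a quotient in the group. -/
theorem extendUnitary_mem_cliffordGroup (f : Fin m ↪ Fin N) {U : QUnitary d m}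
    (hU : U ∈ cliffordGroup d m) : extendUnitary f U ∈ cliffordGroup d N := by
  have split : ∀ a : PauliIndex d N, ∃ b : PauliIndex d m, ∃ D ∈ pauliGroup d N,
      weylUnitary a = extendUnitary f (weylUnitary b) * D ∧
      ∀ V : QUnitary d m, D * extendUnitary f V = extendUnitary f V * D := by
    intro a
    set b : PauliIndex d m := (a.1 ∘ f, a.2 ∘ f) with hb
    refine ⟨b, (extendUnitary f (weylUnitary b))⁻¹ * weylUnitary a,
      mul_mem (inv_mem (extendUnitary_mem_pauliGroup f (weylUnitary_mem b))) (weylUnitary_mem a),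
      by group, fun V => ?_⟩
    obtain ⟨c, e, hc, he⟩ : ∃ (c : ℂ) (e : PauliIndex d N), (e.1 ∘ f = 0 ∧ e.2 ∘ f = 0) ∧
        (((extendUnitary f (weylUnitary b))⁻¹ * weylUnitary a : QUnitary d N) : QOp d N) =
          c • shiftClock e := by
      have ht : qTau d ≠ 0 := by
        intro h
        simpa [h] using norm_qTau d
      have h2 : shiftClock a = (ZMod.stdAddChar (-((a - extendIndex f b).1 ⬝ᵥ
          (extendIndex f b).2)) : ℂ)⁻¹ • (shiftClock (extendIndex f b) *
          shiftClock (a - extendIndex f b)) := by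
        rw [shiftClock_mul, smul_smul, inv_mul_cancel₀ (stdAddChar_ne_zero _), one_smul,
          add_sub_cancel]
      have h3 : shiftClock (extendIndex f b) = ((qTau d)⁻¹ ^ (∑ i, ((extendIndex f b).1 i).val *
          ((extendIndex f b).2 i).val))⁻¹ • (extendUnitary f (weylUnitary b) : QOp d N) := by
        rw [coe_extendUnitary]
        change _ = _ • extendOp f (weyl b)
        rw [extendOp_weyl, weyl_eq_smul, smul_smul,
          inv_mul_cancel₀ (pow_ne_zero _ (inv_ne_zero ht)), one_smul]
      refine ⟨(qTau d)⁻¹ ^ (∑ i, (a.1 i).val * (a.2 i).val) *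
        ((ZMod.stdAddChar (-((a - extendIndex f b).1 ⬝ᵥ (extendIndex f b).2)) : ℂ)⁻¹ *
        ((qTau d)⁻¹ ^ (∑ i, ((extendIndex f b).1 i).val *
          ((extendIndex f b).2 i).val))⁻¹), a - extendIndex f b, ⟨?_, ?_⟩, ?_⟩
      · rw [Prod.fst_sub, Pi.sub_comp, extendIndex, extend_comp, sub_self]
      · rw [Prod.snd_sub, Pi.sub_comp, extendIndex, extend_comp, sub_self]
      · rw [Submonoid.coe_mul]
        change _ * weyl a = _
        rw [weyl_eq_smul, h2, h3, smul_mul_assoc, smul_smul, smul_smul, mul_smul_comm, ← mul_assoc,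
          ← Submonoid.coe_mul, inv_mul_cancel, Submonoid.coe_one, one_mul, mul_assoc]
    apply Subtype.ext
    change (((extendUnitary f (weylUnitary b))⁻¹ * weylUnitary a : QUnitary d N) : QOp d N) *
      extendOp f V = extendOp f V *
      (((extendUnitary f (weylUnitary b))⁻¹ * weylUnitary a : QUnitary d N) : QOp d N)
    rw [he, smul_mul_assoc, mul_smul_comm,
      shiftClock_commute_extendOp f hc.1 hc.2]
  refine mem_cliffordGroup_of_conj (fun a => ?_) (fun a => ?_)
  · obtain ⟨b, D, hD, ha, hDV⟩ := split a
    have e : extendUnitary f U * weylUnitary a * (extendUnitary f U)⁻¹ =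
        extendUnitary f (U * weylUnitary b * U⁻¹) * D := by
      rw [ha, extendUnitary_mul, extendUnitary_mul, mul_assoc, mul_assoc, ← extendUnitary_inv, hDV]
      simp only [mul_assoc]
    rw [e]
    exact mul_mem (extendUnitary_mem_pauliGroup f (conj_mem_pauliGroup hU (weylUnitary_mem b))) hD
  · obtain ⟨b, D, hD, ha, hDV⟩ := split a
    have e : (extendUnitary f U)⁻¹ * weylUnitary a * extendUnitary f U =
        extendUnitary f (U⁻¹ * weylUnitary b * U) * D := by
      rw [ha, extendUnitary_mul, extendUnitary_mul, mul_assoc, mul_assoc, hDV, extendUnitary_inv]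
      simp only [mul_assoc]
    rw [e]
    exact mul_mem (extendUnitary_mem_pauliGroup f (conj_mem_pauliGroup' hU (weylUnitary_mem b))) hD

end Extension

/-! ### Padding with zeros and permuting qudits. -/

section Padding

variable {d : ℕ} [Fact d.Prime] {k m n N : ℕ}

/-- The isometry placing the given qudits at the positions `f` and zeros everywhere else. -/
def padIso (d : ℕ) [Fact d.Prime] (f : Fin m ↪ Fin N) :
    Matrix (Fin N → ZMod d) (Fin m → ZMod d) ℂ :=
  Matrix.of fun X x => if X = Function.extend f x 0 then 1 else 0

theorem mul_padIso_apply (f : Fin m ↪ Fin N) {α : Type*} (M : Matrix α (Fin N → ZMod d) ℂ) (i : α)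
    (x : Fin m → ZMod d) : (M * padIso d f) i x = M i (Function.extend f x 0) := by
  simp [Matrix.mul_apply, padIso]

theorem padIso_conjTranspose_mul_apply (f : Fin m ↪ Fin N) {α : Type*}
    (M : Matrix (Fin N → ZMod d) α ℂ) (x : Fin m → ZMod d) (i : α) :
    ((padIso d f)ᴴ * M) x i = M (Function.extend f x 0) i := by
  simp [Matrix.mul_apply, padIso]

theorem padIso_conjTranspose_mul_self (f : Fin m ↪ Fin N) : (padIso d f)ᴴ * padIso d f = 1 := by
  ext x y
  rw [padIso_conjTranspose_mul_apply, padIso, Matrix.of_apply, Matrix.one_apply]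
  have h : Function.extend f x (0 : Fin N → ZMod d) = Function.extend f y 0 ↔ x = y := by
    refine ⟨fun h => ?_, by rintro rfl; rfl⟩
    rw [← extend_comp f x 0, h, extend_comp]
  simp only [h]

open Classical in
theorem padIso_mul_apply (f : Fin m ↪ Fin N) {α : Type*} (M : Matrix (Fin m → ZMod d) α ℂ)
    (X : Fin N → ZMod d) (i : α) :
    (padIso d f * M) X i = if AgreeOff f X 0 then M (X ∘ f) i else 0 := by
  rw [Matrix.mul_apply]
  simp only [padIso, Matrix.of_apply, ite_mul, one_mul, zero_mul]
  have h : ∀ x : Fin m → ZMod d, X = Function.extend f x 0 ↔ AgreeOff f X 0 ∧ X ∘ f = x := by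
    intro x
    rw [eq_iff_agreeOff (f := f), extend_comp]
    refine and_congr (forall₂_congr fun i hi => ?_) Iff.rfl
    rw [Function.extend_apply' _ _ _ hi]
  simp only [h]
  split_ifs with h0
  · simp [h0]
  · simp [h0]

theorem extendOp_mul_padIso (f : Fin m ↪ Fin N) (B : QOp d m) :
    extendOp f B * padIso d f = padIso d f * B := by
  ext X y
  rw [mul_padIso_apply, padIso_mul_apply, extendOp_apply, extend_comp]
  have h : AgreeOff f X (Function.extend f y 0) ↔ AgreeOff f X 0 :=
    forall₂_congr fun i hi => by rw [Function.extend_apply' _ _ _ hi]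
  classical exact if_congr h rfl rfl

theorem extend_extend {d : ℕ} {m n N : ℕ} (f : Fin m ↪ Fin n) (g : Fin n ↪ Fin N) (x : Fin m → ZMod d) :
    Function.extend g (Function.extend f x 0) 0 = Function.extend (f.trans g) x 0 := by
  funext i
  by_cases hg : i ∈ Set.range g
  · obtain ⟨j, rfl⟩ := hg
    rw [g.injective.extend_apply]
    by_cases hf : j ∈ Set.range f
    · obtain ⟨k, rfl⟩ := hf
      rw [f.injective.extend_apply]
      exact ((f.trans g).injective.extend_apply x 0 k).symm
    · rw [Function.extend_apply' _ _ _ hf, Function.extend_apply' _ _ _ _]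
      · rfl
      · rintro ⟨k, hk⟩
        exact hf ⟨k, g.injective hk⟩
  · rw [Function.extend_apply' _ _ _ hg, Function.extend_apply' _ _ _ _]
    rintro ⟨k, hk⟩
    exact hg ⟨f k, hk⟩

theorem padIso_mul_padIso (f : Fin m ↪ Fin n) (g : Fin n ↪ Fin N) :
    padIso d g * padIso d f = padIso d (f.trans g) := by
  ext X x
  rw [mul_padIso_apply, padIso, padIso, Matrix.of_apply, Matrix.of_apply, extend_extend]

/-- The conditions make the square of embeddings cartesian: the positions that `g'` fills with zeros
are sent by `f'` to positions that `g` fills with zeros. Compressing `B ⊗ 1` by the zeros then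
compresses only the factor `B`. -/
theorem padIso_pushout (f : Fin m ↪ Fin N) {m' N' : ℕ} (g : Fin N ↪ Fin N') (g' : Fin m ↪ Fin m')
    (f' : Fin m' ↪ Fin N') (h : ∀ i, g (f i) = f' (g' i))
    (h' : ∀ j, j ∉ Set.range g' → f' j ∉ Set.range g) (B : QOp d m') :
    (padIso d g)ᴴ * extendOp f' B * padIso d g =
      extendOp f ((padIso d g')ᴴ * B * padIso d g') := by
  ext x y
  rw [mul_padIso_apply, padIso_conjTranspose_mul_apply, extendOp_apply, extendOp_apply,
    mul_padIso_apply, padIso_conjTranspose_mul_apply]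
  have hc : ∀ x : Fin N → ZMod d,
      Function.extend g x 0 ∘ f' = Function.extend g' (x ∘ f) (0 : Fin m' → ZMod d) := by
    intro x
    funext j
    by_cases hj : j ∈ Set.range g'
    · obtain ⟨i, rfl⟩ := hj
      rw [Function.comp_apply, ← h, g.injective.extend_apply, g'.injective.extend_apply,
        Function.comp_apply]
    · rw [Function.comp_apply, Function.extend_apply' _ _ _ (h' j hj),
        Function.extend_apply' _ _ _ hj]
      rfl
  have ha : AgreeOff f' (Function.extend g x 0) (Function.extend g y 0) ↔ AgreeOff f x y := by
    constructor
    · intro H i hi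
      have := H (g i) ?_
      · rwa [g.injective.extend_apply, g.injective.extend_apply] at this
      · rintro ⟨j, hj⟩
        by_cases hj' : j ∈ Set.range g'
        · obtain ⟨l, rfl⟩ := hj'
          exact hi ⟨l, g.injective (by rw [h, hj])⟩
        · exact h' j hj' ⟨i, hj.symm⟩
    · intro H i hi
      by_cases hg : i ∈ Set.range g
      · obtain ⟨j, rfl⟩ := hg
        rw [g.injective.extend_apply, g.injective.extend_apply]
        refine H j ?_
        rintro ⟨l, rfl⟩
        exact hi ⟨g' l, (h l).symm⟩
      · rw [Function.extend_apply' _ _ _ hg, Function.extend_apply' _ _ _ hg]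
  rw [hc, hc]
  classical exact if_congr ha rfl rfl

/-- The unitary permuting the qudits of a register. -/
def permUnitary (d : ℕ) [Fact d.Prime] (e : Equiv.Perm (Fin N)) : QUnitary d N :=
  ⟨padIso d e.toEmbedding, Matrix.mem_unitaryGroup_iff'.2 (padIso_conjTranspose_mul_self _)⟩

theorem permUnitary_conj (e : Equiv.Perm (Fin N)) (g : QUnitary d N) :
    permUnitary d e * g * (permUnitary d e)⁻¹ = extendUnitary e.toEmbedding g := by
  rw [mul_inv_eq_iff_eq_mul]
  exact Subtype.ext (extendOp_mul_padIso _ _).symm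

theorem permUnitary_mem_cliffordGroup (e : Equiv.Perm (Fin N)) :
    permUnitary d e ∈ cliffordGroup d N := by
  refine mem_cliffordGroup_of_conj (fun a => ?_) (fun a => ?_)
  · rw [permUnitary_conj]
    exact extendUnitary_mem_pauliGroup _ (weylUnitary_mem a)
  · have h : weylUnitary a = extendUnitary e.toEmbedding (weylUnitary (a.1 ∘ e, a.2 ∘ e)) := by
      apply Subtype.ext
      rw [coe_extendUnitary]
      change weyl a = extendOp _ (weyl _)
      rw [extendOp_weyl]
      congr 1
      have hx : ∀ v : Fin N → ZMod d, Function.extend e.toEmbedding (v ∘ e) 0 = v := by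
        intro v
        funext i
        obtain ⟨j, rfl⟩ := e.surjective i
        exact e.injective.extend_apply _ _ j
      exact Prod.ext (hx _).symm (hx _).symm
    rw [h, ← permUnitary_conj]
    simpa [mul_assoc] using weylUnitary_mem (a.1 ∘ e, a.2 ∘ e)

end Padding

/-! ### Kraus maps, partial traces and appended states. -/

section Superoperators

variable {d : ℕ} [Fact d.Prime] {k l m n N : ℕ}

/-- `ρ ↦ K ρ K†` for a rectangular matrix `K`. -/
def krausMap (K : Matrix (Fin m → ZMod d) (Fin n → ZMod d) ℂ) : QMap d n m where
  toFun ρ := K * ρ * Kᴴ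
  map_add' ρ ρ' := by rw [Matrix.mul_add, Matrix.add_mul]
  map_smul' c ρ := by simp

theorem krausMap_apply (K : Matrix (Fin m → ZMod d) (Fin n → ZMod d) ℂ) (ρ : QOp d n) :
    krausMap K ρ = K * ρ * Kᴴ := rfl

theorem conjMap_eq_krausMap (K : QOp d n) : conjMap K = krausMap K := rfl

theorem krausMap_comp (K : Matrix (Fin m → ZMod d) (Fin n → ZMod d) ℂ)
    (L : Matrix (Fin n → ZMod d) (Fin k → ZMod d) ℂ) :
    krausMap K ∘ₗ krausMap L = krausMap (K * L) := by
  apply LinearMap.ext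
  intro ρ
  simp only [LinearMap.comp_apply, krausMap_apply, Matrix.conjTranspose_mul, Matrix.mul_assoc]

theorem krausMap_smul (c : ℂ) (K : Matrix (Fin m → ZMod d) (Fin n → ZMod d) ℂ) :
    krausMap (c • K) = (star c * c) • krausMap K := by
  apply LinearMap.ext
  intro ρ
  simp only [LinearMap.smul_apply, krausMap_apply, Matrix.conjTranspose_smul, Matrix.smul_mul,
    Matrix.mul_smul, smul_smul]

theorem krausMap_zero :
    krausMap (0 : Matrix (Fin m → ZMod d) (Fin n → ZMod d) ℂ) = 0 := by
  apply LinearMap.ext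
  intro ρ
  simp [krausMap_apply]

theorem krausMap_one : krausMap (1 : QOp d n) = LinearMap.id := by
  apply LinearMap.ext
  intro ρ
  simp [krausMap_apply]

theorem trace_mul_krausMap (K : Matrix (Fin m → ZMod d) (Fin n → ZMod d) ℂ) (B : QOp d m)
    (A : QOp d n) : (B * krausMap K A).trace = (Kᴴ * B * K * A).trace := by
  rw [krausMap_apply, ← Matrix.mul_assoc, Matrix.trace_mul_comm]
  simp only [Matrix.mul_assoc]

/-- The Heisenberg picture. Under the trace pairing the partial trace is dual to `extendOp`, so
identities between superoperators become matrix identities. -/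
theorem qMap_ext {E F : QMap d n m}
    (h : ∀ (B : QOp d m) (A : QOp d n), (B * E A).trace = (B * F A).trace) : E = F :=
  LinearMap.ext fun A => Matrix.ext_iff_trace_mul_left.2 fun B => h B A

/-- Splitting a string into its first `m` letters and the rest. -/
def extendStringEquiv (d : ℕ) (h : m ≤ N) :
    (Fin m → ZMod d) × (Fin (N - m) → ZMod d) ≃ (Fin N → ZMod d) :=
  (Fin.appendEquiv m (N - m)).trans
    ((finCongr (Nat.add_sub_of_le h)).arrowCongr (Equiv.refl _))

omit [Fact d.Prime] in
theorem extendStringEquiv_apply (h : m ≤ N) (x : Fin m → ZMod d) (z : Fin (N - m) → ZMod d) :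
    extendStringEquiv d h (x, z) = extendString h x z := rfl

omit [Fact d.Prime] in
theorem extendString_castLE (h : m ≤ N) (x : Fin m → ZMod d) (z : Fin (N - m) → ZMod d) :
    extendString h x z ∘ Fin.castLEEmb h = x := by
  funext i
  have : Fin.cast (Nat.add_sub_of_le h).symm (Fin.castLE h i) = Fin.castAdd (N - m) i := rfl
  simp [extendString, this]

omit [Fact d.Prime] in
theorem extend_extendString (h : m ≤ N) (v x : Fin m → ZMod d) (z : Fin (N - m) → ZMod d) :
    Function.extend (Fin.castLEEmb h) v (extendString h x z) = extendString h v z := by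
  conv_lhs => rw [← extendString_castLE h v z]
  apply extend_comp_of_agreeOff
  intro i hi
  have hm : m ≤ i := by
    by_contra hlt
    exact hi ⟨⟨i, by omega⟩, rfl⟩
  have : Fin.cast (Nat.add_sub_of_le h).symm i = Fin.natAdd m ⟨i - m, by omega⟩ := by
    ext
    simp
    omega
  rw [extendString, extendString, this, Fin.append_right, Fin.append_right]

theorem trace_mul_partialTrace (h : m ≤ N) (B : QOp d m) (A : QOp d N) :
    (B * partialTrace h A).trace = (extendOp (Fin.castLEEmb h) B * A).trace := by
  have hr : (extendOp (Fin.castLEEmb h) B * A).trace =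
      ∑ X, ∑ v, B (X ∘ Fin.castLEEmb h) v * A (Function.extend (Fin.castLEEmb h) v X) X := by
    rw [Matrix.trace]
    refine Finset.sum_congr rfl fun X _ => ?_
    rw [Matrix.diag_apply, Matrix.mul_apply]
    simp only [extendOp_apply, ite_mul, zero_mul]
    rw [sum_agreeOff (Fin.castLEEmb h) X]
    simp only [extend_comp]
  rw [hr, ← (extendStringEquiv d h).sum_comp, Fintype.sum_prod_type, Matrix.trace]
  refine Finset.sum_congr rfl fun x _ => ?_
  rw [Matrix.diag_apply, Matrix.mul_apply, Finset.sum_comm]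
  refine Finset.sum_congr rfl fun v _ => ?_
  simp only [extendStringEquiv_apply, extendString_castLE, extend_extendString]
  rw [← Finset.mul_sum]
  rfl

theorem partialTrace_comp_partialTrace (h : k ≤ m) (h' : m ≤ N) :
    (partialTrace h ∘ₗ partialTrace h' : QMap d N k) = partialTrace (h.trans h') := by
  apply qMap_ext
  intro B A
  rw [LinearMap.comp_apply, trace_mul_partialTrace, trace_mul_partialTrace, trace_mul_partialTrace,
    ← extendOp_trans]
  rfl

theorem partialTrace_self : (partialTrace le_rfl : QMap d n n) = LinearMap.id := by
  apply qMap_ext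
  intro B A
  rw [trace_mul_partialTrace, LinearMap.id_apply]
  congr 2
  ext x y
  rw [extendOp_apply, if_pos]
  · rfl
  · exact fun i hi => absurd ⟨i, rfl⟩ hi

theorem krausMap_comp_partialTrace (h : m ≤ N) (K : QOp d m) :
    krausMap K ∘ₗ partialTrace h = partialTrace h ∘ₗ krausMap (extendOp (Fin.castLEEmb h) K) := by
  apply qMap_ext
  intro B A
  rw [LinearMap.comp_apply, LinearMap.comp_apply, trace_mul_krausMap, trace_mul_partialTrace,
    trace_mul_partialTrace, trace_mul_krausMap, map_mul, map_mul, extendOp_conjTranspose]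

theorem padIso_refl : padIso d (Fin.castLEEmb (le_refl n)) = 1 := by
  ext X x
  rw [← one_mul (padIso d _), mul_padIso_apply]
  refine congrArg ((1 : QOp d n) X) (funext fun i => ?_)
  exact (Fin.castLEEmb (le_refl n)).injective.extend_apply x 0 i

theorem partialTrace_comp_padIso (h : m ≤ N) :
    partialTrace h ∘ₗ krausMap (padIso d (Fin.castLEEmb h)) = LinearMap.id := by
  apply qMap_ext
  intro B A
  rw [LinearMap.comp_apply, trace_mul_partialTrace, trace_mul_krausMap, Matrix.mul_assoc _ _ (padIso _ _),
    extendOp_mul_padIso, ← Matrix.mul_assoc, padIso_conjTranspose_mul_self, Matrix.one_mul,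
    LinearMap.id_apply]

theorem castLEEmb_trans (h : k ≤ m) (h' : m ≤ N) :
    (Fin.castLEEmb h).trans (Fin.castLEEmb h') = Fin.castLEEmb (h.trans h') := rfl

/-- Enlarging the ancilla register of a dilation. -/
theorem partialTrace_pad (hm : m ≤ N) (hn : n ≤ N) {N' : ℕ} (hN : N ≤ N') (U : QOp d N)
    (P : QOp d n) :
    (partialTrace hm ∘ₗ krausMap (U * padIso d (Fin.castLEEmb hn) * P) : QMap d n m) =
      partialTrace (hm.trans hN) ∘ₗ krausMap (extendOp (Fin.castLEEmb hN) U *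
        padIso d (Fin.castLEEmb (hn.trans hN)) * P) := by
  rw [← castLEEmb_trans hn hN, ← padIso_mul_padIso, ← Matrix.mul_assoc, extendOp_mul_padIso,
    ← partialTrace_comp_partialTrace hm hN, Matrix.mul_assoc (padIso d _ * U),
    Matrix.mul_assoc (padIso d _), ← krausMap_comp (padIso d (Fin.castLEEmb hN)),
    LinearMap.comp_assoc, ← LinearMap.comp_assoc _ _ (partialTrace hN), partialTrace_comp_padIso,
    LinearMap.id_comp, Matrix.mul_assoc]

/-- Every injection of registers extends the inclusion of an initial segment up to a
permutation. -/
theorem exists_perm_castLE (h : m ≤ N) (f : Fin m ↪ Fin N) :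
    ∃ e : Equiv.Perm (Fin N), f = (Fin.castLEEmb h).trans e.toEmbedding := by
  classical
  let p := (Fin.castLEEmb h).toEquivRange.symm.trans f.toEquivRange
  refine ⟨Equiv.extendSubtype p, ?_⟩
  ext i
  have h1 : Equiv.extendSubtype p (Fin.castLEEmb h i) =
      p ⟨Fin.castLEEmb h i, ⟨i, rfl⟩⟩ :=
    Equiv.extendSubtype_apply_of_mem p _ ⟨i, rfl⟩
  have h2 : (Fin.castLEEmb h).toEquivRange.symm ⟨Fin.castLEEmb h i, ⟨i, rfl⟩⟩ = i := by
    rw [Equiv.symm_apply_eq]; rfl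
  have h3 : (p ⟨Fin.castLEEmb h i, ⟨i, rfl⟩⟩ : Fin N) = f i := by
    simp only [p, Equiv.trans_apply, h2]
    rfl
  rw [Function.Embedding.trans_apply, Equiv.coe_toEmbedding, h1, h3]

/-- The inclusion of the first `n` and the last `k` qudits of a register of `N + k` qudits. -/
def middleFun (k : ℕ) (h : n ≤ N) : Fin (n + k) → Fin (N + k) :=
  Fin.append (fun i => Fin.castAdd k (Fin.castLE h i)) (fun j => Fin.natAdd N j)

theorem middleFun_injective (k : ℕ) (h : n ≤ N) : Function.Injective (middleFun k h) := by
  rw [middleFun, Fin.append_injective_iff]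
  refine ⟨(Fin.castAdd_injective _ _).comp (Fin.castLE_injective h), Fin.natAdd_injective _ _,
    fun i j e => ?_⟩
  have := congrArg Fin.val e
  simp at this
  omega

/-- The inclusion of the first `n` and the last `k` qudits as an embedding. -/
def middleEmb (k : ℕ) (h : n ≤ N) : Fin (n + k) ↪ Fin (N + k) :=
  ⟨middleFun k h, middleFun_injective k h⟩

theorem middleEmb_castAdd (k : ℕ) (h : n ≤ N) (i : Fin n) :
    middleEmb k h (Fin.castAdd k i) = Fin.castAdd k (Fin.castLE h i) := by
  have e : ⇑(middleEmb k h) = middleFun k h := rfl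
  rw [e, middleFun, Fin.append_left]

theorem middleEmb_natAdd (k : ℕ) (h : n ≤ N) (j : Fin k) :
    middleEmb k h (Fin.natAdd n j) = Fin.natAdd N j := by
  have e : ⇑(middleEmb k h) = middleFun k h := rfl
  rw [e, middleFun, Fin.append_right]

/-- Appending zeros after a partial trace can be postponed. -/
theorem padIso_comp_partialTrace (k : ℕ) (h : n ≤ N) :
    ∃ R ∈ cliffordGroup d (N + k),
      krausMap (padIso d (Fin.castLEEmb (Nat.le_add_right n k))) ∘ₗ partialTrace h =
      partialTrace (Nat.add_le_add_right h k) ∘ₗ krausMap ((R : QOp d (N + k)) *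
        padIso d (Fin.castLEEmb (Nat.le_add_right N k))) := by
  -- Zeros appended after the trace follow the `n` kept qudits, but zeros appended before it follow
  -- all `N`. The inverse of the permutation `e` moves them into place.
  obtain ⟨e, he⟩ := exists_perm_castLE (Nat.add_le_add_right h k) (middleEmb k h)
  refine ⟨(permUnitary d e)⁻¹, inv_mem (permUnitary_mem_cliffordGroup e), qMap_ext fun B A => ?_⟩
  have hR : (((permUnitary d e)⁻¹ : QUnitary d (N + k)) : QOp d (N + k))ᴴ = permUnitary d e := by
    rw [← Matrix.star_eq_conjTranspose, ← Unitary.coe_star, ← Unitary.star_eq_inv, star_star]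
  have hR' : extendOp e.toEmbedding (extendOp (Fin.castLEEmb (Nat.add_le_add_right h k)) B) *
      permUnitary d e = permUnitary d e * extendOp (Fin.castLEEmb (Nat.add_le_add_right h k)) B :=
    extendOp_mul_padIso _ _
  have hR'' : (permUnitary d e : QOp d (N + k)) *
      ((permUnitary d e)⁻¹ : QUnitary d (N + k)) = 1 := by
    rw [← Submonoid.coe_mul, mul_inv_cancel, Submonoid.coe_one]
  rw [LinearMap.comp_apply, LinearMap.comp_apply, trace_mul_krausMap, trace_mul_partialTrace,
    trace_mul_partialTrace, trace_mul_krausMap, Matrix.conjTranspose_mul, hR]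
  congr 2
  rw [← padIso_pushout (Fin.castLEEmb h) (Fin.castLEEmb (Nat.le_add_right N k))
    (Fin.castLEEmb (Nat.le_add_right n k)) (middleEmb k h), he, extendOp_trans]
  · calc _ = (padIso d (Fin.castLEEmb (Nat.le_add_right N k)))ᴴ *
          (extendOp e.toEmbedding (extendOp (Fin.castLEEmb (Nat.add_le_add_right h k)) B) *
          ((permUnitary d e : QOp d (N + k)) *
          (((permUnitary d e)⁻¹ : QUnitary d (N + k)) : QOp d (N + k)))) *
          padIso d (Fin.castLEEmb (Nat.le_add_right N k)) := by rw [hR'', mul_one]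
      _ = _ := by
        rw [← mul_assoc (extendOp _ _), hR']
        simp only [Matrix.mul_assoc]
  · intro i
    have : Fin.castLEEmb (Nat.le_add_right n k) i = Fin.castAdd k i := rfl
    rw [this, middleEmb_castAdd]
    rfl
  · intro j
    refine Fin.addCases (fun i => ?_) (fun i => ?_) j
    · exact fun hi => absurd ⟨i, rfl⟩ hi
    · intro _
      rw [middleEmb_natAdd]
      rintro ⟨l, hl⟩
      have := congrArg Fin.val hl
      simp at this
      omega

theorem appendState_zeroState (ρ : QOp d n) :
    appendState (zeroState d k) ρ = krausMap (padIso d (Fin.castLEEmb (Nat.le_add_right n k))) ρ := by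
  have h : ∀ X : Fin (n + k) → ZMod d, AgreeOff (Fin.castLEEmb (Nat.le_add_right n k)) X 0 ↔
      (fun j => X (Fin.natAdd n j)) = 0 := by
    intro X
    constructor
    · intro h
      funext j
      refine h _ ?_
      rintro ⟨l, hl⟩
      have := congrArg Fin.val hl
      simp at this
      omega
    · intro h i
      refine Fin.addCases (fun i => ?_) (fun i => ?_) i
      · exact fun hi => absurd ⟨i, rfl⟩ hi
      · exact fun _ => congrFun h i
  ext X Y
  rw [krausMap_apply]
  have e : padIso d (Fin.castLEEmb (Nat.le_add_right n k)) * ρ *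
      (padIso d (Fin.castLEEmb (Nat.le_add_right n k)))ᴴ =
      (padIso d (Fin.castLEEmb (Nat.le_add_right n k)) *
      (padIso d (Fin.castLEEmb (Nat.le_add_right n k)) * ρ)ᴴ)ᴴ := by
    simp [Matrix.mul_assoc]
  rw [e, Matrix.conjTranspose_apply, padIso_mul_apply, Matrix.conjTranspose_apply, padIso_mul_apply]
  simp only [appendState, zeroState, LinearMap.coe_mk, AddHom.coe_mk, Matrix.of_apply]
  rw [Matrix.single_apply]
  have hX := h X
  have hY := h Y
  by_cases h1 : AgreeOff (Fin.castLEEmb (Nat.le_add_right n k)) X 0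
  · by_cases h2 : AgreeOff (Fin.castLEEmb (Nat.le_add_right n k)) Y 0
    · rw [if_pos ⟨(hX.1 h1).symm, (hY.1 h2).symm⟩, if_pos h1, if_pos h2, star_star, mul_one]
      rfl
    · rw [if_neg (fun hn => h2 (hY.2 hn.2.symm)), if_neg h2, star_zero, mul_zero]
  · rw [if_neg (fun hn => h1 (hX.2 hn.1.symm)), if_neg h1, star_zero, mul_zero, ite_self, star_zero]

theorem extendOp_castAdd_mul (ρ : QOp d n) (σ : QOp d k) :
    extendOp (Fin.castAddEmb k) ρ * extendOp (Fin.natAddEmb n) σ = appendState σ ρ := by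
  ext X Y
  have h1 : Function.extend (Fin.castAddEmb k) (fun i => Y (Fin.castAdd k i)) X ∘ (Fin.natAddEmb n) =
      fun j => X (Fin.natAdd n j) := by
    funext j
    refine Function.extend_apply' _ _ _ ?_
    rintro ⟨l, hl⟩
    have := congrArg Fin.val hl
    simp at this
    omega
  rw [Matrix.mul_apply]
  simp only [extendOp_apply (Fin.castAddEmb k), ite_mul, zero_mul]
  rw [sum_agreeOff (Fin.castAddEmb k) X, Finset.sum_eq_single (fun i => Y (Fin.castAdd k i))]
  · rw [extend_comp, extendOp_apply, if_pos, h1]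
    · rfl
    · intro i
      refine Fin.addCases (fun i => ?_) (fun i => ?_) i
      · exact fun _ => (Fin.castAddEmb k).injective.extend_apply _ _ i
      · exact fun hi => absurd ⟨i, rfl⟩ hi
  · intro v _ hv
    rw [extendOp_apply, if_neg, mul_zero]
    intro ha
    apply hv
    funext i
    have := ha (Fin.castAdd k i) ?_
    · rw [← this]
      exact ((Fin.castAddEmb k).injective.extend_apply v X i).symm
    · rintro ⟨l, hl⟩
      have := congrArg Fin.val hl
      simp at this
      omega
  · simp

theorem extendOp_natAdd_mul (ρ : QOp d n) (σ : QOp d k) :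
    extendOp (Fin.natAddEmb n) σ * extendOp (Fin.castAddEmb k) ρ = appendState σ ρ := by
  have h := extendOp_castAdd_mul ρᴴ σᴴ
  rw [extendOp_conjTranspose, extendOp_conjTranspose, ← Matrix.conjTranspose_mul] at h
  rw [← Matrix.conjTranspose_conjTranspose (_ * _), h]
  ext X Y
  simp [appendState]

theorem appendState_conj (W : QOp d k) (σ : QOp d k) :
    (appendState (W * σ * Wᴴ) : QMap d n (n + k)) =
      krausMap (extendOp (Fin.natAddEmb n) W) ∘ₗ appendState σ := by
  apply LinearMap.ext
  intro ρ
  rw [LinearMap.comp_apply, krausMap_apply, ← extendOp_conjTranspose, ← extendOp_castAdd_mul,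
    ← extendOp_castAdd_mul, map_mul, map_mul, ← mul_assoc, ← mul_assoc, ← mul_assoc]
  congr 2
  rw [extendOp_castAdd_mul, extendOp_natAdd_mul]

end Superoperators

/-! ### Countable convex combinations in finite dimension. -/

section SigmaConvexity

/-- A nonempty convex set missing the origin lies in a closed half-space. -/
theorem exists_halfSpace_of_zero_notMem {F : Type*} [NormedAddCommGroup F] [NormedSpace ℝ F]
    [FiniteDimensional ℝ F] {D : Set F} (hD : Convex ℝ D) (hne : D.Nonempty) (h0 : (0 : F) ∉ D) :
    ∃ f : F →ₗ[ℝ] ℝ, f ≠ 0 ∧ ∀ y ∈ D, 0 ≤ f y := by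
  by_cases hi : (interior D).Nonempty
  · obtain ⟨f, hf⟩ := geometric_hahn_banach_open_point hD.interior isOpen_interior
      (fun h => h0 (interior_subset h))
    rw [map_zero] at hf
    refine ⟨-(f : F →ₗ[ℝ] ℝ), ?_, fun y hy => ?_⟩
    · obtain ⟨y, hy⟩ := hi
      intro h
      have h1 := LinearMap.congr_fun h y
      have h2 := hf y hy
      simp at h1
      linarith
    · have hy' : y ∈ closure (interior D) := by
        rw [hD.closure_interior_eq_closure_of_nonempty_interior hi]
        exact subset_closure hy
      have hcl : IsClosed {z : F | f z ≤ 0} := isClosed_le f.continuous continuous_const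
      have : f y ≤ 0 := closure_minimal (fun z hz => (hf z hz).le) hcl hy'
      simpa using this
  -- With empty interior, `D` lies in a proper affine subspace. A nonzero functional vanishing on
  -- its direction is constant on `D`, and its sign can be chosen.
  · obtain ⟨y₀, hy₀⟩ := hne
    have haff : affineSpan ℝ D ≠ ⊤ := fun h =>
      hi (hD.interior_nonempty_iff_affineSpan_eq_top.2 h)
    have hdir : (affineSpan ℝ D).direction < ⊤ := by
      refine lt_top_iff_ne_top.2 fun h => haff ?_
      exact (AffineSubspace.direction_eq_top_iff_of_nonempty
        ⟨y₀, subset_affineSpan ℝ D hy₀⟩).1 h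
    obtain ⟨f, hf, hker⟩ := Submodule.exists_le_ker_of_lt_top _ hdir
    have hc : ∀ y ∈ D, f y = f y₀ := by
      intro y hy
      have : y - y₀ ∈ (affineSpan ℝ D).direction :=
        AffineSubspace.vsub_mem_direction (subset_affineSpan ℝ D hy) (subset_affineSpan ℝ D hy₀)
      have h := hker this
      rw [LinearMap.mem_ker, map_sub, sub_eq_zero] at h
      exact h
    rcases le_total 0 (f y₀) with h | h
    · exact ⟨f, hf, fun y hy => by rw [hc y hy]; exact h⟩
    · exact ⟨-f, neg_ne_zero.2 hf, fun y hy => by rw [LinearMap.neg_apply, hc y hy]; linarith⟩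

/-- Convex sets in finite dimension are closed under countable convex combinations. -/
theorem Convex.mem_of_hasSum {E : Type*} [AddCommGroup E] [Module ℝ E] [FiniteDimensional ℝ E]
    {C : Set E} (hC : Convex ℝ C) {p : ℕ → ℝ} (hp : ∀ j, 0 ≤ p j) (hp1 : HasSum p 1) {v : ℕ → E}
    (hv : ∀ j, v j ∈ C) {x : E} (hx : ∀ f : E →ₗ[ℝ] ℝ, HasSum (fun j => p j * f (v j)) (f x)) :
    x ∈ C := by
  -- Separation takes place inside the span of the differences that carry weight, so that a nonzero
  -- functional there cannot vanish on all of them. Coordinates supply the norm that `E` is not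
  -- given.
  set S : Set E := {w | ∃ j, p j ≠ 0 ∧ w = v j - x} with hS
  set W := Submodule.span ℝ S with hW
  let e : W ≃ₗ[ℝ] (Fin (Module.finrank ℝ W) → ℝ) := (Module.finBasis ℝ W).equivFun
  let D : Set (Fin (Module.finrank ℝ W) → ℝ) := {y | (e.symm y : E) + x ∈ C}
  have hDmem : ∀ j (hj : p j ≠ 0), e ⟨v j - x, Submodule.subset_span ⟨j, hj, rfl⟩⟩ ∈ D := by
    intro j hj
    simp only [D, Set.mem_ofPred_eq, LinearEquiv.symm_apply_apply, sub_add_cancel]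
    exact hv j
  have hD : Convex ℝ D := by
    intro y hy z hz a b ha hb hab
    have := hC hy hz ha hb hab
    simp only [D, Set.mem_ofPred_eq, map_add, map_smul, Submodule.coe_add, Submodule.coe_smul]
    convert this using 1
    rw [smul_add, smul_add, add_add_add_comm, ← add_smul, hab, one_smul]
  have hne : D.Nonempty := by
    by_contra hD0
    have : ∀ j, p j = 0 := fun j => by
      by_contra hj
      exact hD0 ⟨_, hDmem j hj⟩
    have h2 : HasSum p 0 := by simp [funext this]
    exact zero_ne_one (h2.unique hp1)
  by_contra hxC
  have h0 : (0 : Fin (Module.finrank ℝ W) → ℝ) ∉ D := by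
    simpa [D] using hxC
  obtain ⟨f, hf, hpos⟩ := exists_halfSpace_of_zero_notMem hD hne h0
  obtain ⟨g, hg⟩ := (f ∘ₗ e.toLinearMap).exists_extend
  have hgW : ∀ w : W, g w = f (e w) := fun w => LinearMap.congr_fun hg w
  have hsum : HasSum (fun j => p j * g (v j - x)) 0 := by
    have := (hx g).sub (hp1.mul_right (g x))
    rw [one_mul, sub_self] at this
    refine this.congr_fun fun j => ?_
    rw [map_sub]; ring
  have hnn : ∀ j, 0 ≤ p j * g (v j - x) := by
    intro j
    by_cases hj : p j = 0
    · rw [hj, zero_mul]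
    · refine mul_nonneg (hp j) ?_
      have := hgW ⟨v j - x, Submodule.subset_span ⟨j, hj, rfl⟩⟩
      rw [this]
      exact hpos _ (hDmem j hj)
  -- A nonnegative series with sum zero vanishes termwise, so `g` kills a spanning set of `W`,
  -- against `f ≠ 0`.
  have hz := (hasSum_zero_iff_of_nonneg hnn).1 hsum
  have hker : W ≤ LinearMap.ker g := by
    rw [hW, Submodule.span_le]
    rintro _ ⟨j, hj, rfl⟩
    exact (mul_eq_zero.1 (congrFun hz j)).resolve_left hj
  apply hf
  apply LinearMap.ext
  intro y
  have := hgW (e.symm y)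
  rw [LinearEquiv.apply_symm_apply] at this
  rw [← this]
  exact hker (e.symm y).2

end SigmaConvexity

/-! ### Stabiliser codes and their measurement. -/

section Codes

variable {d n : ℕ} [Fact d.Prime]

theorem coe_stdAddChar_zero_smul {α : Type*} [AddCommMonoid α] [Module ℂ α] (v : α) :
    (ZMod.stdAddChar (0 : ZMod d) : ℂ) • v = v := by
  rw [AddChar.map_zero_eq_one, one_smul]

theorem trace_eq_rank {I : Type*} [Fintype I] [DecidableEq I] {P : Matrix I I ℂ}
    (hP : IsIdempotentElem P) : P.trace = (P.rank : ℂ) := by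
  have h : IsIdempotentElem (Matrix.toLin' P) := by
    change Matrix.toLin' P ∘ₗ Matrix.toLin' P = _
    rw [← Matrix.toLin'_mul, hP.eq]
  rw [← Matrix.trace_toLin'_eq, (LinearMap.IsIdempotentElem.isProj_range _ h).trace]
  rfl

theorem eq_zero_of_trace_eq_zero {I : Type*} [Fintype I] [DecidableEq I] {P : Matrix I I ℂ}
    (hP : IsIdempotentElem P) (h0 : P.trace = 0) : P = 0 := by
  have h : IsIdempotentElem (Matrix.toLin' P) := by
    change Matrix.toLin' P ∘ₗ Matrix.toLin' P = _
    rw [← Matrix.toLin'_mul, hP.eq]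
  rw [← Matrix.trace_toLin'_eq, LinearMap.IsIdempotentElem.trace_eq_zero_iff h] at h0
  exact (LinearEquiv.map_eq_zero_iff _).1 h0

/-- The unitaries of the Pauli group fixing `M` from the left. -/
def pauliStabiliser {α : Type*} (M : Matrix (Fin n → ZMod d) α ℂ) : Subgroup (QUnitary d n) where
  carrier := {g | g ∈ pauliGroup d n ∧ (g : QOp d n) * M = M}
  mul_mem' := fun {g h} hg hh => ⟨mul_mem hg.1 hh.1, by
    rw [Submonoid.coe_mul, Matrix.mul_assoc, hh.2, hg.2]⟩
  one_mem' := ⟨one_mem _, by rw [Submonoid.coe_one, Matrix.one_mul]⟩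
  inv_mem' := fun {g} hg => ⟨inv_mem hg.1, by
    conv_lhs => rw [← hg.2]
    rw [← Matrix.mul_assoc, ← Submonoid.coe_mul, inv_mul_cancel, Submonoid.coe_one,
      Matrix.one_mul]⟩

/-- `P` is a code projector of rank `d ^ k`, given as a linear combination of its stabilisers. -/
structure IsCode (P : QOp d n) (k : ℕ) : Prop where
  isStarProjection : IsStarProjection P
  trace_eq : P.trace = (d : ℂ) ^ k
  mem_span : P ∈ Submodule.span ℂ ((fun g : QUnitary d n => (g : QOp d n)) '' pauliStabiliser P)

theorem isCode_one (d n : ℕ) [Fact d.Prime] : IsCode (1 : QOp d n) n where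
  isStarProjection := .one _
  trace_eq := by simp [Matrix.trace_one]
  mem_span := Submodule.subset_span ⟨1, one_mem _, rfl⟩

theorem IsCode.ne_zero {P : QOp d n} {k : ℕ} (hP : IsCode P k) : P ≠ 0 := by
  rintro rfl
  have := hP.trace_eq
  rw [Matrix.trace_zero] at this
  exact pow_ne_zero k cast_prime_ne_zero this.symm

theorem IsCode.commute {P : QOp d n} {k : ℕ} (hP : IsCode P k) {A : QOp d n}
    (hA : ∀ g ∈ pauliStabiliser P, Commute (g : QOp d n) A) : Commute P A := by
  have h : ∀ M ∈ Submodule.span ℂ ((fun g : QUnitary d n => (g : QOp d n)) '' pauliStabiliser P),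
      Commute M A := by
    intro M hM
    induction hM using Submodule.span_induction with
    | mem x hx =>
      obtain ⟨g, hg, rfl⟩ := hx
      exact hA g hg
    | zero => exact Commute.zero_left A
    | add x y _ _ hx hy => exact hx.add_left hy
    | smul c x _ hx => exact hx.smul_left c
  exact h P hP.mem_span

/-- Two stabilisers of `P ≠ 0` commute because their commutator is a phase fixing `P`. A vector `v`
fixed by all stabilisers is fixed by `P`: as a combination of stabilisers, `P` multiplies `v` and
`P` by the same scalar, and `P * P = P` makes this scalar `1`. -/
theorem IsCode.isCodeProjector {P : QOp d n} {k : ℕ} (hP : IsCode P k) : IsCodeProjector P := by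
  refine ⟨pauliStabiliser P, ⟨fun g hg => hg.1, fun s hs t ht => ?_, fun s hs h => ?_⟩,
    hP.isStarProjection, fun v => ⟨fun hv s hs => ?_, fun hv => ?_⟩⟩
  · obtain ⟨k, hk⟩ := exists_commutation hs.1 ht.1
    apply Subtype.ext
    rw [Submonoid.coe_mul, Submonoid.coe_mul, hk]
    have h1 : ((s : QOp d n) * t) * P = (ZMod.stdAddChar k : ℂ) • (((t : QOp d n) * s) * P) := by
      rw [hk, smul_mul_assoc]
    rw [mul_assoc, ht.2, hs.2, mul_assoc, hs.2, ht.2] at h1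
    have h2 : (ZMod.stdAddChar k : ℂ) = 1 :=
      smul_left_injective ℂ hP.ne_zero (by simpa using h1.symm)
    rw [h2, one_smul]
  · have h1 := hs.2
    rw [h, smul_mul_assoc, one_mul] at h1
    have h2 : (ZMod.stdAddChar (1 : ZMod d) : ℂ) = 1 :=
      smul_left_injective ℂ hP.ne_zero (by simpa using h1)
    exact stdAddChar_ne_one one_ne_zero h2
  · conv_lhs => rw [← hv]
    rw [Matrix.mulVec_mulVec, hs.2, hv]
  · have h : ∀ M ∈ Submodule.span ℂ ((fun g : QUnitary d n => (g : QOp d n)) '' pauliStabiliser P),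
        ∃ c : ℂ, M * P = c • P ∧ M *ᵥ v = c • v := by
      intro M hM
      induction hM using Submodule.span_induction with
      | mem x hx =>
        obtain ⟨g, hg, rfl⟩ := hx
        exact ⟨1, by rw [one_smul]; exact hg.2, by rw [one_smul]; exact hv g hg⟩
      | zero => exact ⟨0, by simp, by simp⟩
      | add x y _ _ hx hy =>
        obtain ⟨a, ha, ha'⟩ := hx
        obtain ⟨b, hb, hb'⟩ := hy
        exact ⟨a + b, by rw [add_mul, ha, hb, add_smul],
          by rw [Matrix.add_mulVec, ha', hb', add_smul]⟩
      | smul c x _ hx =>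
        obtain ⟨a, ha, ha'⟩ := hx
        exact ⟨c * a, by rw [smul_mul_assoc, ha, smul_smul],
          by rw [Matrix.smul_mulVec, ha', smul_smul]⟩
    obtain ⟨c, hc, hc'⟩ := h P hP.mem_span
    have h1 : c = 1 := by
      rw [hP.isStarProjection.isIdempotentElem.eq] at hc
      exact smul_left_injective ℂ hP.ne_zero (by simpa using hc.symm)
    rw [hc', h1, one_smul]

/-- Measuring a Pauli operator that acts nontrivially on a code reduces its dimension by a factor
of `d`. -/
theorem IsCode.measure {P : QOp d n} {k : ℕ} (hP : IsCode P k) {b : PauliIndex d n}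
    (hb : Commute (weyl b) P) (hs : ∀ c : ℂ, weyl b * P ≠ c • P) :
    ∃ k', k = k' + 1 ∧ ∀ x : ZMod d, IsCode (spectralProj (weyl b) x * P) k' := by
  have hw := weyl_pow_d b
  -- If `w(b)^j g` has nonzero trace for a stabiliser `g`, it is a scalar, so `w(b)^j` is scalar on
  -- `P`. Raising to the power `j⁻¹` mod `d` makes `w(b)` scalar on `P`, which is excluded. Hence
  -- all outcomes have projections of equal trace.
  have htr : ∀ j : ZMod d, j ≠ 0 → ∀ M ∈ Submodule.span ℂ
      ((fun g : QUnitary d n => (g : QOp d n)) '' pauliStabiliser P),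
      (weyl b ^ j.val * M).trace = 0 := by
    intro j hj M hM
    induction hM using Submodule.span_induction with
    | mem x hx =>
      obtain ⟨g, hg, rfl⟩ := hx
      by_contra h0
      have hmem : weylUnitary b ^ j.val * g ∈ pauliGroup d n :=
        mul_mem (pow_mem (weylUnitary_mem b) _) hg.1
      obtain ⟨c, -, hc⟩ := eq_smul_one_of_trace_ne_zero hmem h0
      have h1 : weyl b ^ j.val * (g : QOp d n) = c • 1 := hc
      have h2 : weyl b ^ j.val * P = c • P := by
        conv_lhs => rw [← hg.2, ← mul_assoc, h1, smul_mul_assoc, one_mul]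
      have h3 := pow_mul_eigen h2 (j⁻¹).val
      rw [← pow_mul, pow_eq_pow_mod _ hw] at h3
      have h4 : j.val * (j⁻¹).val % d = 1 := by
        have : Fact (1 < d) := ⟨(Fact.out : d.Prime).one_lt⟩
        rw [← ZMod.val_mul, mul_inv_cancel₀ hj, ZMod.val_one]
      rw [h4, pow_one] at h3
      exact hs _ h3
    | zero => simp
    | add x y _ _ hx hy => rw [mul_add, Matrix.trace_add, hx, hy, add_zero]
    | smul c x _ hx => rw [mul_smul_comm, Matrix.trace_smul, hx, smul_zero]
  have htrace : ∀ x : ZMod d, (spectralProj (weyl b) x * P).trace = (d : ℂ)⁻¹ * (d : ℂ) ^ k := by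
    intro x
    rw [spectralProj, smul_mul_assoc, Matrix.trace_smul, Finset.sum_mul, Matrix.trace_sum,
      Finset.sum_eq_single (0 : ZMod d)]
    · rw [mul_zero, neg_zero, ZMod.val_zero, pow_zero, coe_stdAddChar_zero_smul, one_mul,
        hP.trace_eq, smul_eq_mul]
    · intro j _ hj
      rw [smul_mul_assoc, Matrix.trace_smul, htr j hj P hP.mem_span, smul_zero]
    · simp
  have hproj : ∀ x : ZMod d, IsStarProjection (spectralProj (weyl b) x * P) := fun x =>
    (isStarProjection_spectralProj hw (weyl_mem_unitaryGroup b) x).mul hP.isStarProjection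
      (commute_spectralProj hb.symm x).symm
  -- For `k = 0` the trace `1 / d` would have to be the integer rank of a projection.
  have hk : k ≠ 0 := by
    rintro rfl
    have h1 := htrace 0
    rw [trace_eq_rank (hproj 0).isIdempotentElem, pow_zero, mul_one] at h1
    replace h1 := congrArg (fun z => z * (d : ℂ)) h1
    simp only [inv_mul_cancel₀ (cast_prime_ne_zero (d := d))] at h1
    have h2 : (spectralProj (weyl b) (0 : ZMod d) * P).rank * d = 1 := by exact_mod_cast h1
    exact (Fact.out : d.Prime).ne_one (Nat.eq_one_of_mul_eq_one_left h2)
  obtain ⟨k', rfl⟩ := Nat.exists_eq_succ_of_ne_zero hk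
  refine ⟨k', rfl, fun x => ⟨hproj x, ?_, ?_⟩⟩
  · rw [htrace, pow_succ', inv_mul_cancel_left₀ cast_prime_ne_zero]
  -- The new stabilisers are `ω^{-xj} w(b)^j`. These phases lie in the Pauli group because `b ≠ 0`
  -- has a noncommuting partner.
  · have hb0 : b ≠ 0 := by
      rintro rfl
      apply hs (weyl (0 : PauliIndex d n) 0 0)
      simp [weyl_eq_smul, shiftClock_zero]
    have hphase : ∀ y : ZMod d, phaseUnitary n y ∈ pauliGroup d n := by
      obtain ⟨b', l, hl, hbb'⟩ := exists_weyl_noncomm hb0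
      refine phaseUnitary_mem (weylUnitary_mem b) (weylUnitary_mem b') hl ?_
      change weyl b * weyl b' = _ • (weyl b' * weyl b)
      rw [weyl_eq_smul b, smul_mul_assoc, hbb', mul_smul_comm, smul_comm]
    set Q := spectralProj (weyl b) x * P with hQ
    have hPQ : ∀ g ∈ pauliStabiliser P, g ∈ pauliStabiliser Q := by
      intro g hg
      refine ⟨hg.1, ?_⟩
      rw [hQ, (commute_spectralProj hb.symm x).symm.eq, ← mul_assoc, hg.2]
    have hwQ : ∀ j : ZMod d, phaseUnitary n (-(x * j)) * weylUnitary b ^ j.val ∈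
        pauliStabiliser Q := by
      intro j
      refine ⟨mul_mem (hphase _) (pow_mem (weylUnitary_mem b) _), ?_⟩
      change (((ZMod.stdAddChar (-(x * j)) : ℂ) • (1 : QOp d n)) * weyl b ^ j.val) *
        (spectralProj (weyl b) x * P) = spectralProj (weyl b) x * P
      rw [smul_mul_assoc, one_mul, smul_mul_assoc, ← mul_assoc,
        pow_mul_eigen (mul_spectralProj hw x), stdAddChar_pow_val, smul_mul_assoc, smul_smul,
        ← AddChar.map_add_eq_mul, neg_add_cancel, coe_stdAddChar_zero_smul]
    have h1 : ∀ M ∈ Submodule.span ℂ ((fun g : QUnitary d n => (g : QOp d n)) ''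
        pauliStabiliser P), spectralProj (weyl b) x * M ∈ Submodule.span ℂ
        ((fun g : QUnitary d n => (g : QOp d n)) '' pauliStabiliser Q) := by
      intro M hM
      induction hM using Submodule.span_induction with
      | mem y hy =>
        obtain ⟨g, hg, rfl⟩ := hy
        rw [spectralProj, smul_mul_assoc, Finset.sum_mul]
        refine Submodule.smul_mem _ _ (Submodule.sum_mem _ fun j _ => Submodule.subset_span
          ⟨_, mul_mem (hwQ j) (hPQ g hg), ?_⟩)
        change (((ZMod.stdAddChar (-(x * j)) : ℂ) • (1 : QOp d n)) * weyl b ^ j.val) *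
          (g : QOp d n) = _
        rw [smul_mul_assoc, one_mul]
      | zero => rw [mul_zero]; exact zero_mem _
      | add y z _ _ hy hz => rw [mul_add]; exact add_mem hy hz
      | smul c y _ hy => rw [mul_smul_comm]; exact Submodule.smul_mem _ _ hy
    exact h1 P hP.mem_span

end Codes

/-! ### Pauli operators acting on padded codes. -/

section Dichotomy

variable {d n N : ℕ} [Fact d.Prime]

theorem coe_weylUnitary (a : PauliIndex d n) : (weylUnitary a : QOp d n) = weyl a := rfl

theorem weyl_fst (z : Fin n → ZMod d) : weyl ((z, 0) : PauliIndex d n) = shiftClock (z, 0) := by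
  simp [weyl_eq_smul]

theorem weyl_snd (x : Fin n → ZMod d) : weyl ((0, x) : PauliIndex d n) = shiftClock (0, x) := by
  simp [weyl_eq_smul]

theorem clock_mul_padIso (f : Fin n ↪ Fin N) {z : Fin N → ZMod d} (hz : z ∘ f = 0) :
    shiftClock ((z, 0) : PauliIndex d N) * padIso d f = padIso d f := by
  ext X y
  rw [mul_padIso_apply, shiftClock_apply, padIso, Matrix.of_apply, add_zero]
  split_ifs with h
  · have : z ⬝ᵥ X = 0 := by
      rw [h, dotProduct_comm, extend_dotProduct, hz, dotProduct_zero]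
    rw [this, AddChar.map_zero_eq_one]
  · rfl

theorem shiftClock_mul_padIso (f : Fin n ↪ Fin N) {a : PauliIndex d N}
    (ha : ∀ i, i ∉ Set.range f → a.2 i = 0) :
    shiftClock a * padIso d f = padIso d f * shiftClock (a.1 ∘ f, a.2 ∘ f) := by
  ext X y
  rw [mul_padIso_apply, padIso_mul_apply, shiftClock_apply, shiftClock_apply]
  have h : X = Function.extend f y 0 + a.2 ↔ AgreeOff f X 0 ∧ X ∘ f = y + a.2 ∘ f := by
    rw [eq_iff_agreeOff (f := f), Pi.add_comp, extend_comp]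
    refine and_congr (forall₂_congr fun i hi => ?_) Iff.rfl
    rw [Pi.add_apply, Function.extend_apply' _ _ _ hi, ha i hi, add_zero]
  by_cases h₁ : AgreeOff f X 0
  · by_cases h₂ : X ∘ f = y + a.2 ∘ f
    · rw [if_pos (h.2 ⟨h₁, h₂⟩), if_pos h₁, if_pos h₂]
      have : X = Function.extend f (X ∘ f) 0 :=
        (extend_comp_of_agreeOff fun i hi => (h₁ i hi).symm).symm
      rw [this, dotProduct_comm, extend_dotProduct, dotProduct_comm, extend_comp]
    · rw [if_neg (fun hn => h₂ (h.1 hn).2), if_pos h₁, if_neg h₂]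
  · rw [if_neg (fun hn => h₁ (h.1 hn).1), if_neg h₁]

/-- A Pauli operator on a padded code either fails to commute with some stabiliser of the padded
code, or acts as a Pauli operator on the original register. -/
theorem pauli_dichotomy (f : Fin n ↪ Fin N) (P : QOp d n) {B : QUnitary d N}
    (hB : B ∈ pauliGroup d N) (hBd : (B : QOp d N) ^ d = 1) :
    (∃ A ∈ pauliStabiliser (padIso d f * P), (A : QOp d N) * B ≠ B * A) ∨
    ∃ (b : PauliIndex d n) (c : ZMod d),
      (B : QOp d N) * padIso d f = (ZMod.stdAddChar c : ℂ) • (padIso d f * weyl b) ∧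
      ∀ g ∈ pauliStabiliser P, Commute (g : QOp d n) (weyl b) := by
  by_cases H : ∃ A ∈ pauliStabiliser (padIso d f * P), (A : QOp d N) * B ≠ B * A
  · exact Or.inl H
  push Not at H
  right
  obtain ⟨c, a, hc, hBa⟩ := exists_eq_smul_shiftClock hB
  -- `Z` on a padded qudit `i` stabilises the padded code. Commuting with it forbids `B` to shift
  -- that qudit.
  have ha : ∀ i, i ∉ Set.range f → a.2 i = 0 := by
    intro i hi
    have hz : (Pi.single i 1 : Fin N → ZMod d) ∘ f = 0 := by
      funext j
      refine Pi.single_eq_of_ne ?_ _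
      rintro rfl
      exact hi ⟨j, rfl⟩
    have h1 := H (weylUnitary (Pi.single i 1, 0)) ⟨weylUnitary_mem _, by
      rw [coe_weylUnitary, weyl_fst, ← Matrix.mul_assoc, clock_mul_padIso f hz]⟩
    rw [coe_weylUnitary, weyl_fst, hBa, mul_smul_comm, smul_mul_assoc, shiftClock_comm, smul_smul, mul_comm c,
      mul_smul] at h1
    have hne : c • (shiftClock a * shiftClock ((Pi.single i 1, 0) : PauliIndex d N)) ≠ 0 := by
      rw [shiftClock_mul]
      exact smul_ne_zero hc (smul_ne_zero (stdAddChar_ne_zero _) (shiftClock_ne_zero _))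
    have h2 := smul_left_injective ℂ hne (h1.trans (one_smul ℂ _).symm)
    by_contra h0
    refine stdAddChar_ne_one ?_ h2
    simpa using h0
  have hJ : (B : QOp d N) * padIso d f = padIso d f * (c • shiftClock (a.1 ∘ f, a.2 ∘ f)) := by
    rw [hBa, Matrix.smul_mul, shiftClock_mul_padIso f ha, Matrix.mul_smul]
  have cancel : ∀ X Y : QOp d n, padIso d f * X = padIso d f * Y → X = Y := by
    intro X Y h
    have := congrArg (fun M => (padIso d f)ᴴ * M) h
    simpa only [← Matrix.mul_assoc, padIso_conjTranspose_mul_self, Matrix.one_mul] using this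
  have hpow : (c • shiftClock ((a.1 ∘ f, a.2 ∘ f) : PauliIndex d n)) ^ d = 1 := by
    apply cancel
    have hj : ∀ j : ℕ, (B : QOp d N) ^ j * padIso d f =
        padIso d f * (c • shiftClock ((a.1 ∘ f, a.2 ∘ f) : PauliIndex d n)) ^ j := by
      intro j
      induction j with
      | zero => simp
      | succ j ih =>
        rw [pow_succ, Matrix.mul_assoc, hJ, ← Matrix.mul_assoc, ih, Matrix.mul_assoc, ← pow_succ]
    rw [← hj, hBd, Matrix.one_mul, Matrix.mul_one]
  obtain ⟨k, hk⟩ := eq_stdAddChar_smul_weyl hpow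
  rw [hk, Matrix.mul_smul] at hJ
  refine ⟨_, k, hJ, fun g hg => ?_⟩
  have h1 := H (extendUnitary f g) ⟨extendUnitary_mem_pauliGroup f hg.1, by
    rw [coe_extendUnitary, ← Matrix.mul_assoc, extendOp_mul_padIso, Matrix.mul_assoc, hg.2]⟩
  have h2 := congrArg (fun M => M * padIso d f) h1
  simp only [Matrix.mul_assoc, coe_extendUnitary, extendOp_mul_padIso] at h2
  rw [hJ, Matrix.mul_smul, ← Matrix.mul_assoc, extendOp_mul_padIso, ← Matrix.mul_assoc, hJ,
    Matrix.smul_mul, Matrix.mul_assoc, Matrix.mul_assoc] at h2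
  exact cancel _ _ (smul_right_injective _ (stdAddChar_ne_zero k) h2)

end Dichotomy

/-! ### Stabiliser states as Clifford images of the zero state. -/

section StabiliserStates

variable {d n k : ℕ} [Fact d.Prime]

theorem pauli_pow_eq_one_of_fixed {α : Type*} {M : Matrix (Fin n → ZMod d) α ℂ} (hM : M ≠ 0)
    {A : QUnitary d n} (hA : A ∈ pauliStabiliser M) : (A : QOp d n) ^ d = 1 := by
  obtain ⟨c, a, -, hAa⟩ := exists_eq_smul_shiftClock hA.1
  have hz : d • a = 0 := by ext i <;> simp
  have h1 : (A : QOp d n) ^ d = (c ^ d * ZMod.stdAddChar (-((d.choose 2 : ZMod d) *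
      (a.1 ⬝ᵥ a.2)))) • (1 : QOp d n) := by
    rw [hAa, smul_pow, shiftClock_pow, hz, shiftClock_zero, smul_smul]
  have h2 := pow_mul_eigen (c := 1) (by rw [one_smul]; exact hA.2) d (B := (A : QOp d n)) (M := M)
  rw [one_pow, h1, Matrix.smul_mul, Matrix.one_mul] at h2
  rw [h1, smul_left_injective ℂ hM h2, one_smul]

theorem pauliGroup_le_cliffordGroup : pauliGroup d n ≤ cliffordGroup d n :=
  Subgroup.le_normalizer

/-- The vector `|0 … 0⟩` as a column. -/
def zeroKet (d k : ℕ) [Fact d.Prime] : Matrix (Fin k → ZMod d) (Fin 0 → ZMod d) ℂ :=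
  padIso d (Fin.castLEEmb (Nat.zero_le k))

theorem zeroKet_apply (X : Fin k → ZMod d) (x : Fin 0 → ZMod d) :
    zeroKet d k X x = if X = 0 then 1 else 0 := by
  have : Function.extend (Fin.castLEEmb (Nat.zero_le k)) x 0 = 0 := by
    funext i
    refine Function.extend_apply' _ _ _ ?_
    rintro ⟨j, -⟩
    exact j.elim0
  rw [zeroKet, padIso, Matrix.of_apply, this]

theorem zeroKet_conjTranspose_mul_self : (zeroKet d k)ᴴ * zeroKet d k = 1 :=
  padIso_conjTranspose_mul_self _

theorem zeroKet_mul_conjTranspose : zeroKet d k * (zeroKet d k)ᴴ = zeroState d k := by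
  ext X Y
  rw [Matrix.mul_apply, Fintype.sum_unique, Matrix.conjTranspose_apply, zeroKet_apply,
    zeroKet_apply, zeroState, Matrix.single_apply]
  by_cases hX : X = 0 <;> by_cases hY : Y = 0 <;> simp [hX, hY, eq_comm]

theorem isStarProjection_zeroState : IsStarProjection (zeroState d k) := by
  rw [← zeroKet_mul_conjTranspose]
  constructor
  · rw [IsIdempotentElem, Matrix.mul_assoc, ← Matrix.mul_assoc (zeroKet d k)ᴴ,
      zeroKet_conjTranspose_mul_self, Matrix.one_mul]
  · rw [IsSelfAdjoint, Matrix.star_eq_conjTranspose, Matrix.conjTranspose_mul,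
      Matrix.conjTranspose_conjTranspose]

theorem trace_zeroState : (zeroState d k).trace = 1 := by
  rw [zeroState, Matrix.trace_single_eq_same]

theorem zeroState_eq_sum : zeroState d k =
    ((d : ℂ) ^ k)⁻¹ • ∑ z : Fin k → ZMod d, weyl ((z, 0) : PauliIndex d k) := by
  ext X Y
  rw [Matrix.smul_apply, Matrix.sum_apply, zeroState, Matrix.single_apply]
  -- Exchanging the roles of `z` and `X` turns the sum over `z` into the trace of `Z(X)`, which
  -- vanishes unless `X = 0`.
  have h : ∀ z : Fin k → ZMod d, weyl ((z, 0) : PauliIndex d k) X Y =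
      if X = Y then shiftClock ((X, 0) : PauliIndex d k) z z else 0 := by
    intro z
    rw [weyl_fst, shiftClock_apply, shiftClock_apply, add_zero, add_zero, if_pos rfl,
      dotProduct_comm]
  simp only [h]
  by_cases hXY : X = Y
  · subst hXY
    simp only [if_true]
    have ht : ∑ z, shiftClock ((X, 0) : PauliIndex d k) z z =
        (shiftClock ((X, 0) : PauliIndex d k)).trace := rfl
    rw [ht]
    by_cases hX : X = 0
    · subst hX
      have h0 : ((0, 0) : PauliIndex d k) = 0 := rfl
      rw [if_pos ⟨rfl, rfl⟩, h0, shiftClock_zero, Matrix.trace_one]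
      simp [inv_mul_cancel₀ (pow_ne_zero k (cast_prime_ne_zero (d := d)))]
    · rw [trace_shiftClock (fun h0 => hX (congrArg Prod.fst h0)),
        if_neg (fun h0 => hX h0.1.symm), smul_zero]
  · rw [if_neg (fun h0 => hXY (h0.1.symm.trans h0.2))]
    simp [hXY]

theorem isCode_zeroState (d k : ℕ) [Fact d.Prime] : IsCode (zeroState d k) 0 where
  isStarProjection := isStarProjection_zeroState
  trace_eq := by rw [trace_zeroState, pow_zero]
  mem_span := by
    suffices h : ((d : ℂ) ^ k)⁻¹ • ∑ z : Fin k → ZMod d, weyl ((z, 0) : PauliIndex d k) ∈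
        Submodule.span ℂ ((fun g : QUnitary d k => (g : QOp d k)) ''
          pauliStabiliser (zeroState d k)) by rwa [← zeroState_eq_sum] at h
    refine Submodule.smul_mem _ _ (Submodule.sum_mem _ fun z _ => Submodule.subset_span
      ⟨weylUnitary (z, 0), ⟨weylUnitary_mem _, ?_⟩, rfl⟩)
    rw [← zeroKet_mul_conjTranspose, ← Matrix.mul_assoc, coe_weylUnitary, weyl_fst, zeroKet,
      clock_mul_padIso]
    funext i
    exact i.elim0

theorem isStabiliserState_zeroState (d k : ℕ) [Fact d.Prime] :
    IsStabiliserState (zeroState d k) := by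
  refine ⟨(isCode_zeroState d k).isCodeProjector, ?_⟩
  have h := trace_eq_rank (isStarProjection_zeroState (d := d) (k := k)).isIdempotentElem
  rw [trace_zeroState] at h
  exact_mod_cast h.symm

theorem conjTranspose_mul_fixed {α : Type*} {s : QUnitary d k}
    {ψ : Matrix (Fin k → ZMod d) α ℂ} (h : (s : QOp d k) * ψ = ψ) : (s : QOp d k)ᴴ * ψ = ψ := by
  conv_lhs => rw [← h]
  rw [← Matrix.mul_assoc, ← Matrix.star_eq_conjTranspose, s.2.1, Matrix.one_mul]

/-- The induction step for reaching stabiliser states: a further stabiliser of `ψ` can be imposed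
on a Clifford image of the zero state that overlaps with `ψ`. -/
theorem exists_clifford_fixed_insert {α : Type*} {ψ : Matrix (Fin k → ZMod d) α ℂ}
    {U : QUnitary d k} (hU : U ∈ cliffordGroup d k)
    (hov : ((U : QOp d k) * zeroKet d k)ᴴ * ψ ≠ 0) {s : QUnitary d k}
    (hs : s ∈ pauliStabiliser ψ) :
    ∃ U' ∈ cliffordGroup d k, ((U' : QOp d k) * zeroKet d k)ᴴ * ψ ≠ 0 ∧
      (s : QOp d k) * ((U' : QOp d k) * zeroKet d k) = (U' : QOp d k) * zeroKet d k ∧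
      ∀ s' : QUnitary d k, s' * s = s * s' → (s' : QOp d k) * ((U : QOp d k) * zeroKet d k) = (U : QOp d k) * zeroKet d k →
        (s' : QOp d k) * ((U' : QOp d k) * zeroKet d k) = (U' : QOp d k) * zeroKet d k := by
  have hψ : ψ ≠ 0 := by
    rintro rfl
    exact hov (Matrix.mul_zero _)
  have hsd := pauli_pow_eq_one_of_fixed hψ hs
  set B : QUnitary d k := U⁻¹ * s * U with hB
  have hBP : B ∈ pauliGroup d k := conj_mem_pauliGroup' hU hs.1
  have hUB : (U : QOp d k) * B = s * U := by
    rw [← Submonoid.coe_mul, ← Submonoid.coe_mul, hB]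
    congr 1
    group
  have hBd : (B : QOp d k) ^ d = 1 := by
    have h1 : B ^ d = 1 := by
      have h2 : s ^ d = 1 := Subtype.ext hsd
      have h3 := conj_pow (i := d) (a := U⁻¹) (b := s)
      rw [inv_inv, h2, mul_one, inv_mul_cancel] at h3
      exact h3
    exact congrArg Subtype.val h1
  -- The zero state is the padding of the trivial code on no qudits. If the pulled-back stabiliser
  -- `B` is random on it, projecting `U|0⟩` to the fixed space of `s` is, up to `√d`, again a
  -- Clifford image; the overlap with `ψ` survives as `s` fixes `ψ`. Otherwise `U|0⟩` is an
  -- eigenvector of `s`, and the overlap forces the eigenvalue `1`.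
  rcases pauli_dichotomy (Fin.castLEEmb (Nat.zero_le k)) (1 : QOp d 0) hBP hBd with
    ⟨A, hA, hAB⟩ | ⟨b, c, hb, -⟩
  · rw [Matrix.mul_one] at hA
    have hne : zeroKet d k ≠ 0 := by
      intro h0
      have := zeroKet_conjTranspose_mul_self (d := d) (k := k)
      rw [h0, Matrix.mul_zero] at this
      exact zero_ne_one this
    obtain ⟨V, hV, hVB⟩ := exists_clifford_of_noncomm hne hA.1 hBP hBd hA.2 hAB 0
    have h0 : (Real.sqrt d : ℂ) ≠ 0 := by
      intro h0
      have := sqrt_mul_sqrt_natCast d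
      rw [h0, zero_mul] at this
      exact cast_prime_ne_zero this.symm
    have hVk : ((U * V : QUnitary d k) : QOp d k) * zeroKet d k =
        (Real.sqrt d : ℂ) • (spectralProj (s : QOp d k) (0 : ZMod d) * ((U : QOp d k) * zeroKet d k)) := by
      have h1 := spectralProj_mul_intertwine (d := d) (B := (s : QOp d k)) (C := (B : QOp d k))
        (M := (U : QOp d k)) (c := 0) (by rw [coe_stdAddChar_zero_smul, hUB]) 0
      rw [sub_zero] at h1
      rw [← Matrix.mul_assoc, h1, Matrix.mul_assoc, hVB, Matrix.mul_smul, smul_smul,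
        mul_inv_cancel₀ h0, one_smul, Submonoid.coe_mul, Matrix.mul_assoc]
    have hproj := isStarProjection_spectralProj hsd s.2 (0 : ZMod d)
    refine ⟨U * V, mul_mem hU hV, ?_, ?_, ?_⟩
    · rw [hVk, Matrix.conjTranspose_smul, Matrix.smul_mul, Matrix.conjTranspose_mul (spectralProj _ _),
        ← Matrix.star_eq_conjTranspose (spectralProj _ _), hproj.isSelfAdjoint.star_eq,
        Matrix.mul_assoc, spectralProj_mul_of_eigen (y := (0 : ZMod d))
          (by rw [coe_stdAddChar_zero_smul, hs.2]), if_pos rfl]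
      exact smul_ne_zero (star_ne_zero.2 h0) hov
    · rw [hVk, Matrix.mul_smul, ← Matrix.mul_assoc, mul_spectralProj hsd, coe_stdAddChar_zero_smul]
    · intro s' hcomm hfix
      have hc : Commute (s' : QOp d k) (s : QOp d k) := congrArg Subtype.val hcomm
      rw [hVk, Matrix.mul_smul, ← Matrix.mul_assoc, (commute_spectralProj hc (0 : ZMod d)).eq,
        Matrix.mul_assoc, hfix]
  · have hb1 : weyl b = 1 := by
      have : b = 0 := by ext i <;> exact i.elim0
      rw [this, weyl_eq_smul, shiftClock_zero]
      simp
    have h1 : (s : QOp d k) * ((U : QOp d k) * zeroKet d k) = (ZMod.stdAddChar c : ℂ) • ((U : QOp d k) * zeroKet d k) := by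
      rw [hb1, Matrix.mul_one] at hb
      rw [← Matrix.mul_assoc, ← hUB, Matrix.mul_assoc, zeroKet, hb, Matrix.mul_smul]
    have h2 : star (ZMod.stdAddChar c : ℂ) = 1 := by
      have h3 : ((s : QOp d k) * ((U : QOp d k) * zeroKet d k))ᴴ * ψ = ((U : QOp d k) * zeroKet d k)ᴴ * ψ := by
        rw [Matrix.conjTranspose_mul, Matrix.mul_assoc, conjTranspose_mul_fixed hs.2]
      rw [h1, Matrix.conjTranspose_smul, Matrix.smul_mul] at h3
      exact smul_left_injective ℂ hov (h3.trans (one_smul ℂ _).symm)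
    have h4 : (ZMod.stdAddChar c : ℂ) = 1 := by
      rw [← star_star (ZMod.stdAddChar c : ℂ), h2, star_one]
    refine ⟨U, hU, hov, by rw [h1, h4, one_smul], fun s' _ h => h⟩

/-- Every stabiliser state is the image of the zero state under a Clifford unitary. -/
theorem IsStabiliserState.exists_clifford {σ : QOp d k} (hσ : IsStabiliserState σ) :
    ∃ W ∈ cliffordGroup d k, σ = W * zeroState d k * (W : QOp d k)ᴴ := by
  obtain ⟨⟨S, hS, hproj, hfix⟩, hrank⟩ := hσ
  have hσ0 : σ ≠ 0 := by
    rintro rfl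
    simp at hrank
  have hSσ : ∀ s ∈ S, s ∈ pauliStabiliser σ := by
    refine fun s hs => ⟨hS.le_pauliGroup hs, ?_⟩
    apply Matrix.toLin'.injective
    apply LinearMap.ext
    intro v
    rw [Matrix.toLin'_apply, Matrix.toLin'_apply, ← Matrix.mulVec_mulVec]
    refine (hfix _).1 ?_ s hs
    rw [Matrix.mulVec_mulVec, hproj.isIdempotentElem.eq]
  -- Induction over Pauli indices, of which there are finitely many. Each index carries at most one
  -- element of `S`, as its phase is determined by fixing `σ ≠ 0`. The start is a basis state
  -- overlapping with `σ`.
  have key : ∀ F : Finset (PauliIndex d k), ∃ U ∈ cliffordGroup d k,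
      ((U : QOp d k) * zeroKet d k)ᴴ * σ ≠ 0 ∧
      ∀ s ∈ S, (∃ a ∈ F, ∃ c : ℂ, (s : QOp d k) = c • shiftClock a) →
        (s : QOp d k) * ((U : QOp d k) * zeroKet d k) = (U : QOp d k) * zeroKet d k := by
    classical
    intro F
    induction F using Finset.induction_on with
    | empty =>
      obtain ⟨y, z, hyz⟩ : ∃ y z, σ y z ≠ 0 := by
        by_contra! h
        exact hσ0 (Matrix.ext h)
      refine ⟨weylUnitary (0, y), pauliGroup_le_cliffordGroup (weylUnitary_mem _), ?_, by simp⟩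
      intro h0
      apply hyz
      have h1 := congrFun (congrFun h0 0) z
      have h2 : ∀ X, (weyl ((0, y) : PauliIndex d k) * zeroKet d k) X 0 =
          if X = y then 1 else 0 := by
        intro X
        rw [weyl_snd, shiftClock_mul_apply, zeroKet_apply]
        simp [sub_eq_zero]
      rw [Matrix.mul_apply] at h1
      simpa only [coe_weylUnitary, Matrix.conjTranspose_apply, h2, apply_ite star, star_one,
        star_zero, ite_mul, one_mul, zero_mul, Finset.sum_ite_eq', Finset.mem_univ, if_true,
        Matrix.zero_apply] using h1
    | insert a F _ ih =>
      obtain ⟨U, hU, hov, hUF⟩ := ih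
      by_cases ha : ∃ s ∈ S, ∃ c : ℂ, (s : QOp d k) = c • shiftClock a
      · obtain ⟨s, hs, c, hc⟩ := ha
        obtain ⟨U', hU', hov', hs', hcomm⟩ := exists_clifford_fixed_insert hU hov (hSσ s hs)
        refine ⟨U', hU', hov', fun t ht hta => ?_⟩
        obtain ⟨a', ha', c', hc'⟩ := hta
        rcases Finset.mem_insert.1 ha' with rfl | ha'
        · have hts : (t : QOp d k) = s := by
            have h1 := (hSσ t ht).2
            have h2 := (hSσ s hs).2
            rw [hc', smul_mul_assoc] at h1
            rw [hc, smul_mul_assoc] at h2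
            have h3 : shiftClock a' * σ ≠ 0 := by
              intro h3
              rw [h3, smul_zero] at h2
              exact hσ0 h2.symm
            rw [hc, hc', smul_left_injective ℂ h3 (h1.trans h2.symm)]
          rw [hts, hs']
        · exact hcomm t (hS.comm t ht s hs) (hUF t ht ⟨a', ha', c', hc'⟩)
      · refine ⟨U, hU, hov, fun t ht hta => ?_⟩
        obtain ⟨a', ha', c', hc'⟩ := hta
        rcases Finset.mem_insert.1 ha' with rfl | ha'
        · exact absurd ⟨t, ht, c', hc'⟩ ha
        · exact hUF t ht ⟨a', ha', c', hc'⟩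
  obtain ⟨W, hW, -, hWS⟩ := key Finset.univ
  refine ⟨W, hW, ?_⟩
  have hWS' : ∀ s ∈ S, (s : QOp d k) * ((W : QOp d k) * zeroKet d k) = (W : QOp d k) * zeroKet d k := by
    intro s hs
    obtain ⟨c, a, -, hc⟩ := exists_eq_smul_shiftClock (hS.le_pauliGroup hs)
    exact hWS s hs ⟨a, Finset.mem_univ _, c, hc⟩
  have hσW : σ * ((W : QOp d k) * zeroKet d k) = (W : QOp d k) * zeroKet d k := by
    apply Matrix.ext_of_mulVec_single
    intro i
    rw [← Matrix.mulVec_mulVec]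
    refine (hfix _).2 fun s hs => ?_
    rw [Matrix.mulVec_mulVec, hWS' s hs]
  set Q : QOp d k := W * zeroState d k * (W : QOp d k)ᴴ with hQ
  have hWu : ((W : QOp d k)ᴴ) * W = 1 := W.2.1
  have hQs : IsStarProjection Q := by
    constructor
    · rw [IsIdempotentElem, hQ]
      calc _ = (W : QOp d k) * (zeroState d k * ((W : QOp d k)ᴴ * W) * zeroState d k) *
            (W : QOp d k)ᴴ := by simp only [mul_assoc]
        _ = _ := by rw [hWu, mul_one, isStarProjection_zeroState.isIdempotentElem.eq]
    · rw [IsSelfAdjoint, hQ, star_mul, star_mul, ← Matrix.star_eq_conjTranspose, star_star,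
        isStarProjection_zeroState.isSelfAdjoint.star_eq, mul_assoc]
  have hσQ : σ * Q = Q := by
    rw [hQ, ← zeroKet_mul_conjTranspose, ← Matrix.mul_assoc (W : QOp d k), Matrix.mul_assoc,
      ← Matrix.mul_assoc σ, hσW]
  -- Since `σ * Q = Q`, the difference `σ - Q` is a projection; both have trace `1`, so it is zero.
  have hdiff := hQs.sub_of_mul_eq_right hproj hσQ
  have htr : (σ - Q).trace = 0 := by
    rw [Matrix.trace_sub, trace_eq_rank hproj.isIdempotentElem, hrank, hQ, Matrix.trace_mul_comm,
      ← mul_assoc, hWu, one_mul, trace_zeroState, Nat.cast_one, sub_self]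
  exact sub_eq_zero.1 (eq_zero_of_trace_eq_zero hdiff.isIdempotentElem htr)

end StabiliserStates

/-! ### Uniqueness and form of the measurement projections. -/

section Measurement

variable {d n : ℕ} [Fact d.Prime]

theorem IsProjectorOnto.eq {P Q : QOp d n} {C : Submodule ℂ ((Fin n → ZMod d) → ℂ)}
    (hP : IsProjectorOnto P C) (hQ : IsProjectorOnto Q C) : P = Q := by
  have key : ∀ {P Q : QOp d n}, IsProjectorOnto P C → IsProjectorOnto Q C → Q * P = P := by
    intro P Q hP hQ
    apply Matrix.toLin'.injective
    apply LinearMap.ext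
    intro v
    rw [Matrix.toLin'_apply, Matrix.toLin'_apply, ← Matrix.mulVec_mulVec]
    refine (hQ.2 _).2 ((hP.2 _).1 ?_)
    rw [Matrix.mulVec_mulVec, hP.1.isIdempotentElem.eq]
  have h1 := key hP hQ
  have h2 := congrArg star (key hQ hP)
  rw [star_mul, hP.1.isSelfAdjoint.star_eq, hQ.1.isSelfAdjoint.star_eq] at h2
  rw [← h1, h2]

theorem isProjectorOnto_spectralProj (a : PauliIndex d n) (x : ZMod d) :
    IsProjectorOnto (spectralProj (weyl a) x)
      (Module.End.eigenspace (Matrix.toLin' (weyl a)) (ZMod.stdAddChar x)) := by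
  refine ⟨isStarProjection_spectralProj (weyl_pow_d a) (weyl_mem_unitaryGroup a) x, fun v => ?_⟩
  rw [Module.End.mem_eigenspace_iff, Matrix.toLin'_apply]
  constructor
  · intro h
    conv_lhs => rw [← h]
    rw [Matrix.mulVec_mulVec, mul_spectralProj (weyl_pow_d a), Matrix.smul_mulVec, h]
  · intro h
    have h1 : weyl a * Matrix.replicateCol Unit v =
        (ZMod.stdAddChar x : ℂ) • Matrix.replicateCol Unit v := by
      rw [← Matrix.replicateCol_mulVec, h, Matrix.replicateCol_smul]
    have h2 := spectralProj_mul_of_eigen h1 x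
    rw [if_pos rfl, ← Matrix.replicateCol_mulVec] at h2
    exact Matrix.replicateCol_injective h2

end Measurement

/-! ### Adaptive code measurements. -/

section CodeTrees

variable {d n m : ℕ} [Fact d.Prime]

/-- `CodeTree d n m P k G`: on the code with projector `P` of dimension `d ^ k`, the superoperator
`G` is an adaptive sequence of Pauli measurements, each acting nontrivially within the code reached
so far, followed by a Clifford unitary on a register padded with zeros and a partial trace. -/
inductive CodeTree (d n m : ℕ) [Fact d.Prime] : QOp d n → ℕ → QMap d n m → Prop
  | leaf {P : QOp d n} {k : ℕ} (hP : IsCode P k) {N : ℕ} (hn : n ≤ N) (hm : m ≤ N)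
      (U : QUnitary d N) (hU : U ∈ cliffordGroup d N) :
      CodeTree d n m P k
        (partialTrace hm ∘ₗ krausMap ((U : QOp d N) * padIso d (Fin.castLEEmb hn) * P))
  | node {P : QOp d n} {k : ℕ} (b : PauliIndex d n) (hb : Commute (weyl b) P)
      (G : ZMod d → QMap d n m)
      (hG : ∀ x, CodeTree d n m (spectralProj (weyl b) x * P) k (G x)) :
      CodeTree d n m P (k + 1) (∑ x, G x)

omit [Fact d.Prime] in
theorem qMap_sum_comp {ι : Type*} [Fintype ι] {l : ℕ} (E : ι → QMap d n m) (F : QMap d l n) :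
    (∑ i, E i) ∘ₗ F = ∑ i, E i ∘ₗ F := by
  apply LinearMap.ext
  intro ρ
  simp

/-- A code tree on a code of dimension `d ^ k` is a protocol with at most `k` rounds. -/
theorem CodeTree.exists_protocol {P : QOp d n} {k : ℕ} {G : QMap d n m}
    (h : CodeTree d n m P k G) :
    ∃ E : QMap d n m, (∀ t : ℕ∞, (k : ℕ∞) ≤ t → StabProtocol d m t n E) ∧
      G = E ∘ₗ krausMap P := by
  induction h with
  | leaf hP hn hm U hU =>
    obtain ⟨r, rfl⟩ := Nat.exists_eq_add_of_le hn
    refine ⟨((LinearMap.id ∘ₗ partialTrace hm) ∘ₗ conjMap (U : QOp d (n + r))) ∘ₗ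
      appendState (zeroState d r), fun t _ => ?_, ?_⟩
    · exact .prepare _ (isStabiliserState_zeroState d r) _
        (.clifford U hU _ (.discard hm _ (.done t)))
    · have h1 : (appendState (zeroState d r) : QMap d n (n + r)) =
          krausMap (padIso d (Fin.castLEEmb hn)) :=
        LinearMap.ext fun ρ => appendState_zeroState ρ
      rw [h1, LinearMap.id_comp, conjMap_eq_krausMap, LinearMap.comp_assoc, LinearMap.comp_assoc,
        krausMap_comp, krausMap_comp, Matrix.mul_assoc]
  | @node P k b hb G hG ih =>
    choose E hE hGE using ih
    refine ⟨∑ x, E x ∘ₗ conjMap (spectralProj (weyl b) x), fun t ht => ?_, ?_⟩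
    · exact .measure (s := (k : ℕ∞)) (by simpa using ht) b _ (isProjectorOnto_spectralProj b) E
        fun x => hE x _ le_rfl
    · rw [qMap_sum_comp]
      refine Finset.sum_congr rfl fun x _ => ?_
      rw [hGE x, conjMap_eq_krausMap, LinearMap.comp_assoc, krausMap_comp]

/-- A code tree measures a family of mutually orthogonal code projectors. -/
theorem CodeTree.exists_measurement {P : QOp d n} {k : ℕ} {G : QMap d n m}
    (h : CodeTree d n m P k G) :
    ∃ N₀ : ℕ, n ≤ N₀ ∧ m ≤ N₀ ∧ ∀ (N : ℕ) (_ : N₀ ≤ N) (hn : n ≤ N) (hm : m ≤ N),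
      ∃ (ι : Type) (_ : Fintype ι) (Q : ι → QOp d n) (U : ι → QUnitary d N),
        (∀ i, IsCodeProjector (Q i)) ∧ (∀ i j, i ≠ j → Q i * Q j = 0) ∧ ∑ i, Q i = P ∧
        (∀ i, U i ∈ cliffordGroup d N) ∧
        G = ∑ i, partialTrace hm ∘ₗ
          krausMap ((U i : QOp d N) * padIso d (Fin.castLEEmb hn) * Q i) := by
  induction h with
  | @leaf P k hP N₀ hn₀ hm₀ U hU =>
    refine ⟨N₀, hn₀, hm₀, fun N hN hn hm => ⟨Unit, inferInstance, fun _ => P,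
      fun _ => extendUnitary (Fin.castLEEmb hN) U, fun _ => hP.isCodeProjector, ?_, by simp,
      fun _ => extendUnitary_mem_cliffordGroup _ hU, ?_⟩⟩
    · exact fun i j hij => absurd (Subsingleton.elim i j) hij
    · rw [partialTrace_pad hm₀ hn₀ hN]
      simp [coe_extendUnitary]
  | @node P k b hb G hG ih =>
    choose N₀ hn₀ hm₀ H using ih
    -- Branches may use ancilla registers of different sizes. The claim holds for every large enough
    -- `N`, so one register serves them all.
    refine ⟨Finset.univ.sup N₀, (hn₀ 0).trans (Finset.le_sup (Finset.mem_univ _)),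
      (hm₀ 0).trans (Finset.le_sup (Finset.mem_univ _)), fun N hN hn hm => ?_⟩
    have H' := fun x => H x N ((Finset.le_sup (Finset.mem_univ x)).trans hN) hn hm
    choose ι hι Q U hQ horth hsum hU hG' using H'
    refine ⟨(x : ZMod d) × ι x, inferInstance, fun i => Q i.1 i.2, fun i => U i.1 i.2,
      fun i => hQ _ _, ?_, ?_, fun i => hU _ _, ?_⟩
    -- Projectors found below the outcome `x` are absorbed by the projector of that branch, so
    -- orthogonality across branches comes from the spectral projections of `w(b)`.
    · have hl : ∀ x i, spectralProj (weyl b) x * P * Q x i = Q x i := by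
        intro x i
        rw [← hsum x, Finset.sum_mul, Finset.sum_eq_single i]
        · obtain ⟨S, -, hS⟩ := hQ x i
          exact hS.1.isIdempotentElem.eq
        · exact fun j _ hj => horth x j i hj
        · simp
      have hr : ∀ x i, Q x i * (spectralProj (weyl b) x * P) = Q x i := by
        intro x i
        rw [← hsum x, Finset.mul_sum, Finset.sum_eq_single i]
        · obtain ⟨S, -, hS⟩ := hQ x i
          exact hS.1.isIdempotentElem.eq
        · exact fun j _ hj => horth x i j hj.symm
        · simp
      rintro ⟨x, i⟩ ⟨y, j⟩ hij
      by_cases hxy : x = y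
      · subst hxy
        exact horth x i j fun h => hij (by rw [h])
      · have h1 := (commute_spectralProj hb.symm x).eq
        calc Q x i * Q y j = Q x i * (P * spectralProj (weyl b) x) *
              (spectralProj (weyl b) y * P * Q y j) := by rw [hl, h1, hr]
          _ = Q x i * (P * (spectralProj (weyl b) x * spectralProj (weyl b) y) * (P * Q y j)) := by
              simp only [mul_assoc]
          _ = 0 := by
              rw [spectralProj_mul_spectralProj (weyl_pow_d b), if_neg hxy, mul_zero, zero_mul,
                mul_zero]
    · rw [Fintype.sum_sigma]
      simp only [hsum]
      rw [← Finset.sum_mul, sum_spectralProj, one_mul]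
    · rw [Fintype.sum_sigma]
      exact Finset.sum_congr rfl fun x _ => hG' x

theorem CodeTree.isCodeMeasurementForm {k : ℕ} {G : QMap d n m} (h : CodeTree d n m 1 k G) :
    IsCodeMeasurementForm G := by
  obtain ⟨N₀, hn₀, hm₀, H⟩ := h.exists_measurement
  obtain ⟨r, rfl⟩ := Nat.exists_eq_add_of_le hn₀
  obtain ⟨ι, _, Q, U, hQ, horth, hsum, hU, hG⟩ := H _ le_rfl hn₀ hm₀
  let e := (Fintype.equivFin ι).symm
  refine ⟨r, hm₀, Fintype.card ι, fun i => Q (e i), fun i => U (e i), fun i => hQ _,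
    fun i j hij => horth _ _ fun h => hij (e.injective h), ?_, fun i => hU _, fun ρ => ?_⟩
  · rw [e.sum_comp Q, hsum]
  · rw [hG, LinearMap.sum_apply, map_sum, ← e.sum_comp]
    refine Finset.sum_congr rfl fun i _ => ?_
    obtain ⟨S, -, hS⟩ := hQ (e i)
    have hstar : (Q (e i))ᴴ = Q (e i) := hS.1.isSelfAdjoint
    rw [appendState_zeroState, LinearMap.comp_apply, krausMap_apply, krausMap_apply]
    simp only [Matrix.conjTranspose_mul, hstar, Matrix.mul_assoc]

end CodeTrees

/-! ### Random choices and convexity. -/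

section Randomness

variable {d n m : ℕ} [Fact d.Prime]

/-- Convergence is known only at each `ρ`. A superoperator is determined by its values on the
finitely many matrix units, so a functional of it is a finite sum of functionals of these values. -/
theorem hasSum_functional {p : ℕ → ℝ} {E : ℕ → QMap d n m} {F : QMap d n m}
    (hF : ∀ ρ, HasSum (fun j => p j • E j ρ) (F ρ)) (f : QMap d n m →ₗ[ℝ] ℝ) :
    HasSum (fun j => p j * f (E j)) (f F) := by
  let ψ (i j : Fin n → ZMod d) : QOp d m →ₗ[ℝ] QMap d n m :=
    { toFun := fun B =>
        { toFun := fun ρ => ρ i j • B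
          map_add' := fun ρ ρ' => by rw [Matrix.add_apply, add_smul]
          map_smul' := fun c ρ => by rw [Matrix.smul_apply, smul_assoc, RingHom.id_apply] }
      map_add' := fun B B' => by apply LinearMap.ext; intro ρ; exact smul_add _ _ _
      map_smul' := fun c B => by apply LinearMap.ext; intro ρ; exact smul_comm _ _ _ }
  have hdec : ∀ G : QMap d n m, f G = ∑ i, ∑ j, f (ψ i j (G (Matrix.single i j 1))) := by
    intro G
    have h : G = ∑ i, ∑ j, ψ i j (G (Matrix.single i j 1)) := by
      apply LinearMap.ext
      intro ρ
      conv_lhs => rw [Matrix.matrix_eq_sum_single ρ]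
      rw [map_sum, LinearMap.sum_apply]
      refine Finset.sum_congr rfl fun i _ => ?_
      rw [map_sum, LinearMap.sum_apply]
      refine Finset.sum_congr rfl fun j _ => ?_
      have : Matrix.single i j (ρ i j) = ρ i j • Matrix.single i j (1 : ℂ) := by
        rw [Matrix.smul_single, smul_eq_mul, mul_one]
      rw [this, map_smul]
      rfl
    conv_lhs => rw [h]
    simp only [map_sum]
  have hterm : ∀ i j, HasSum (fun l => p l * f (ψ i j (E l (Matrix.single i j 1))))
      (f (ψ i j (F (Matrix.single i j 1)))) := by
    intro i j
    have hc : Continuous (f ∘ₗ ψ i j) := LinearMap.continuous_of_finiteDimensional _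
    have := (hF (Matrix.single i j 1)).map (f ∘ₗ ψ i j) hc
    refine this.congr_fun fun l => ?_
    simp
  rw [hdec F]
  have := hasSum_sum (s := Finset.univ) fun i _ => hasSum_sum (s := Finset.univ)
    fun j _ => hterm i j
  refine this.congr_fun fun l => ?_
  rw [hdec (E l), Finset.mul_sum]
  exact Finset.sum_congr rfl fun i _ => Finset.mul_sum _ _ _

/-- Convex combinations of protocols are protocols. -/
theorem convex_stabProtocol (t : ℕ∞) : Convex ℝ {E : QMap d n m | StabProtocol d m t n E} := by
  intro E hE F hF a b ha hb hab
  refine .random (fun j => if j = 0 then a else if j = 1 then b else 0) (fun j => ?_) ?_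
    (fun j => if j = 0 then E else F) (fun j => ?_) _ (fun ρ => ?_)
  · split_ifs <;> simp [ha, hb]
  · have h : HasSum (fun j : ℕ => if j = 0 then a else if j = 1 then b else 0)
        (∑ j ∈ Finset.range 2, if j = 0 then a else if j = 1 then b else 0) := by
      refine hasSum_sum_of_ne_finset_zero fun j hj => ?_
      simp only [Finset.mem_range, not_lt] at hj
      rw [if_neg (by omega), if_neg (by omega)]
    simpa [Finset.sum_range_succ, hab] using h
  · split_ifs
    · exact hE
    · exact hF
  · have h : HasSum (fun j : ℕ => (if j = 0 then a else if j = 1 then b else 0) •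
        (if j = 0 then E else F) ρ) (∑ j ∈ Finset.range 2,
          (if j = 0 then a else if j = 1 then b else 0) • (if j = 0 then E else F) ρ) := by
      refine hasSum_sum_of_ne_finset_zero fun j hj => ?_
      simp only [Finset.mem_range, not_lt] at hj
      rw [if_neg (c := j = 0) (by omega), if_neg (by omega), zero_smul]
    simpa [Finset.sum_range_succ] using h

end Randomness

/-! ### From protocols to convex combinations of code trees. -/

section Reduction

variable {d n m : ℕ} [Fact d.Prime]

/-- A Pauli measurement of uniformly random outcome is a random Clifford unitary. -/
theorem measure_random_mem {C : Set (QMap d n m)} (hC : Convex ℝ C) {N : ℕ}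
    {M : Matrix (Fin N → ZMod d) (Fin n → ZMod d) ℂ} (hM : M ≠ 0) {U A B : QUnitary d N}
    (hU : U ∈ cliffordGroup d N) (hA : A ∈ pauliStabiliser M) (hB : B ∈ pauliGroup d N)
    (hBd : (B : QOp d N) ^ d = 1) (hAB : (A : QOp d N) * B ≠ B * A) (E : ZMod d → QMap d N m)
    (hE : ∀ x, ∀ V ∈ cliffordGroup d N, E x ∘ₗ krausMap ((V : QOp d N) * M) ∈ C) :
    ∑ x, E x ∘ₗ krausMap ((U : QOp d N) * (spectralProj (B : QOp d N) x * M)) ∈ C := by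
  choose V hV hVB using exists_clifford_of_noncomm hM hA.1 hB hBd hA.2 hAB
  have hd : (0 : ℝ) < d := Nat.cast_pos.2 (Fact.out : d.Prime).pos
  -- The factor `1 / √d` enters a Kraus map squared, giving each of the `d` outcomes the weight `1 /
  -- d`.
  have h : ∀ x, E x ∘ₗ krausMap ((U : QOp d N) * (spectralProj (B : QOp d N) x * M)) =
      ((d : ℝ)⁻¹) • (E x ∘ₗ krausMap (((U * V x : QUnitary d N) : QOp d N) * M)) := by
    intro x
    rw [hVB, Matrix.mul_smul, krausMap_smul, Submonoid.coe_mul, Matrix.mul_assoc]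
    have hc : star (Real.sqrt d : ℂ)⁻¹ * (Real.sqrt d : ℂ)⁻¹ = (((d : ℝ)⁻¹ : ℝ) : ℂ) := by
      rw [Complex.star_def, map_inv₀, Complex.conj_ofReal, ← mul_inv, sqrt_mul_sqrt_natCast]
      simp
    rw [hc]
    apply LinearMap.ext
    intro ρ
    rw [LinearMap.comp_apply, LinearMap.smul_apply, map_smul, LinearMap.smul_apply]
    exact Complex.coe_smul _ _
  rw [Finset.sum_congr rfl fun x _ => h x]
  refine hC.sum_mem (fun _ _ => by positivity) ?_ fun x _ => hE x _ (mul_mem hU (hV x))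
  rw [Finset.sum_const, Finset.card_univ, ZMod.card, nsmul_eq_mul, mul_inv_cancel₀ hd.ne']

-- Convex hulls commute with Minkowski sums: independent random choices in the branches can be made
-- jointly in advance.
open scoped Pointwise in
theorem sum_mem_convexHull {V : Type*} [AddCommGroup V] [Module ℝ V] {ι : Type*} [Fintype ι]
    {T : ι → Set V} {C : Set V} (hC : ∀ G : ι → V, (∀ i, G i ∈ T i) → ∑ i, G i ∈ C) {G : ι → V}
    (hG : ∀ i, G i ∈ convexHull ℝ (T i)) : ∑ i, G i ∈ convexHull ℝ C := by
  have h1 : ∑ i, G i ∈ ∑ i, convexHull ℝ (T i) :=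
    Set.finsetSum_mem_finsetSum _ _ _ fun i _ => hG i
  rw [← convexHull_sum] at h1
  refine convexHull_mono ?_ h1
  intro y hy
  obtain ⟨g, hg, rfl⟩ := Set.mem_fintype_sum _ _ |>.1 hy
  exact hC g hg

/-- Running a protocol on the output of a Clifford dilation of a code yields a convex combination of
code trees. -/
theorem StabProtocol.comp_mem_convexHull {t : ℕ∞} {n₁ : ℕ} {E : QMap d n₁ m}
    (hE : StabProtocol d m t n₁ E) :
    ∀ (N : ℕ) (hn : n ≤ N) (h₁ : n₁ ≤ N) (U : QUnitary d N), U ∈ cliffordGroup d N →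
      ∀ (P : QOp d n) (k : ℕ), IsCode P k →
        E ∘ₗ partialTrace h₁ ∘ₗ krausMap ((U : QOp d N) * padIso d (Fin.castLEEmb hn) * P) ∈
          convexHull ℝ {G | CodeTree d n m P k G} := by
  induction hE with
  | done t =>
    intro N hn h₁ U hU P k hP
    exact subset_convexHull _ _ (.leaf hP hn h₁ U hU)
  | @prepare t n₁ l σ hσ E hE ih =>
    intro N hn h₁ U hU P k hP
    obtain ⟨W, hW, rfl⟩ := hσ.exists_clifford
    obtain ⟨R, hR, hRe⟩ := padIso_comp_partialTrace (d := d) l h₁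
    have h0 : (appendState (zeroState d l) : QMap d n₁ (n₁ + l)) =
        krausMap (padIso d (Fin.castLEEmb (Nat.le_add_right n₁ l))) :=
      LinearMap.ext fun ρ => appendState_zeroState ρ
    have key : (E ∘ₗ appendState ((W : QOp d l) * zeroState d l * (W : QOp d l)ᴴ)) ∘ₗ
        partialTrace h₁ ∘ₗ krausMap ((U : QOp d N) * padIso d (Fin.castLEEmb hn) * P) =
        E ∘ₗ partialTrace (Nat.add_le_add_right h₁ l) ∘ₗ
        krausMap (((extendUnitary (Fin.castLEEmb (Nat.add_le_add_right h₁ l))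
          (extendUnitary (Fin.natAddEmb n₁) W) * R *
          extendUnitary (Fin.castLEEmb (Nat.le_add_right N l)) U : QUnitary d (N + l)) :
            QOp d (N + l)) *
          padIso d (Fin.castLEEmb (hn.trans (Nat.le_add_right N l))) * P) := by
      rw [appendState_conj, h0, LinearMap.comp_assoc, LinearMap.comp_assoc,
        ← LinearMap.comp_assoc _ (partialTrace h₁), hRe]
      congr 1
      rw [← LinearMap.comp_assoc, ← LinearMap.comp_assoc, krausMap_comp_partialTrace,
        LinearMap.comp_assoc, LinearMap.comp_assoc, krausMap_comp, krausMap_comp]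
      congr 2
      rw [← castLEEmb_trans hn (Nat.le_add_right N l), ← padIso_mul_padIso, Submonoid.coe_mul,
        Submonoid.coe_mul, coe_extendUnitary, coe_extendUnitary, coe_extendUnitary]
      simp only [← Matrix.mul_assoc]
      congr 2
      simp only [Matrix.mul_assoc, extendOp_mul_padIso]
    rw [key]
    exact ih (N + l) _ _ _ (mul_mem (mul_mem (extendUnitary_mem_cliffordGroup _
      (extendUnitary_mem_cliffordGroup _ hW)) hR) (extendUnitary_mem_cliffordGroup _ hU)) P k hP
  | @clifford t n₁ V hV E hE ih =>
    intro N hn h₁ U hU P k hP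
    have key : (E ∘ₗ conjMap (V : QOp d n₁)) ∘ₗ partialTrace h₁ ∘ₗ
        krausMap ((U : QOp d N) * padIso d (Fin.castLEEmb hn) * P) =
        E ∘ₗ partialTrace h₁ ∘ₗ krausMap (((extendUnitary (Fin.castLEEmb h₁) V * U :
          QUnitary d N) : QOp d N) * padIso d (Fin.castLEEmb hn) * P) := by
      rw [LinearMap.comp_assoc, conjMap_eq_krausMap, ← LinearMap.comp_assoc _ _ (krausMap _),
        krausMap_comp_partialTrace, LinearMap.comp_assoc, krausMap_comp, Submonoid.coe_mul,
        coe_extendUnitary]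
      simp only [Matrix.mul_assoc]
    rw [key]
    exact ih N hn h₁ _ (mul_mem (extendUnitary_mem_cliffordGroup _ hV) hU) P k hP
  | @discard t n₁ n₂ h E hE ih =>
    intro N hn h₁ U hU P k hP
    rw [LinearMap.comp_assoc, ← LinearMap.comp_assoc _ (partialTrace h₁),
      partialTrace_comp_partialTrace]
    exact ih N hn (h.trans h₁) U hU P k hP
  | @measure s t hst n₁ a S hS E hE ih =>
    intro N hn h₁ U hU P k hP
    set J := padIso d (Fin.castLEEmb hn) with hJ
    set A' : QUnitary d N := extendUnitary (Fin.castLEEmb h₁) (weylUnitary a) with hA'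
    set B : QUnitary d N := U⁻¹ * A' * U with hB
    have hBP : B ∈ pauliGroup d N := conj_mem_pauliGroup' hU
      (extendUnitary_mem_pauliGroup _ (weylUnitary_mem a))
    have hA'd : (A' : QOp d N) ^ d = 1 := by
      rw [hA', coe_extendUnitary, ← map_pow, coe_weylUnitary, weyl_pow_d, map_one]
    have hBd : (B : QOp d N) ^ d = 1 := by
      have h2 : A' ^ d = 1 := Subtype.ext hA'd
      have h3 := conj_pow (i := d) (a := U⁻¹) (b := A')
      rw [inv_inv, h2, mul_one, inv_mul_cancel] at h3
      exact congrArg Subtype.val h3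
    have hUB : (A' : QOp d N) * U = (U : QOp d N) * B := by
      rw [← Submonoid.coe_mul, ← Submonoid.coe_mul, hB]
      congr 1
      group
    have key : (∑ x, E x ∘ₗ conjMap (S x)) ∘ₗ partialTrace h₁ ∘ₗ
        krausMap ((U : QOp d N) * J * P) = ∑ x, (E x ∘ₗ partialTrace h₁) ∘ₗ
          krausMap ((U : QOp d N) * (spectralProj (B : QOp d N) x * (J * P))) := by
      rw [qMap_sum_comp]
      refine Finset.sum_congr rfl fun x _ => ?_
      have hSx : S x = spectralProj (weyl a) x := (hS x).eq (isProjectorOnto_spectralProj a x)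
      have h1 := spectralProj_mul_intertwine (d := d) (B := (A' : QOp d N)) (C := (B : QOp d N))
        (M := (U : QOp d N)) (c := 0) (by rw [coe_stdAddChar_zero_smul, hUB]) x
      rw [sub_zero, hA', coe_extendUnitary, coe_weylUnitary, ← extendOp_spectralProj] at h1
      rw [LinearMap.comp_assoc, conjMap_eq_krausMap, ← LinearMap.comp_assoc _ _ (krausMap _),
        krausMap_comp_partialTrace, LinearMap.comp_assoc, krausMap_comp, hSx, LinearMap.comp_assoc,
        Matrix.mul_assoc, ← Matrix.mul_assoc (extendOp _ _), h1, Matrix.mul_assoc]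
    rw [key]
    have hM : J * P ≠ 0 := by
      intro h0
      apply hP.ne_zero
      have h1 := congrArg (fun X => Jᴴ * X) h0
      simpa only [← Matrix.mul_assoc, hJ, padIso_conjTranspose_mul_self, Matrix.one_mul,
        Matrix.mul_zero] using h1
    rcases pauli_dichotomy (Fin.castLEEmb hn) P hBP hBd with ⟨A, hA, hAB⟩ | ⟨b, c, hb, hcomm⟩
    · refine measure_random_mem (convex_convexHull ℝ _) hM hU hA hBP hBd hAB _ fun x V hV => ?_
      rw [← Matrix.mul_assoc, LinearMap.comp_assoc]
      exact ih x N hn h₁ V hV P k hP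
    · have hbP : Commute (weyl b) P := (hP.commute hcomm).symm
      have hx : ∀ x : ZMod d, (U : QOp d N) * (spectralProj (B : QOp d N) x * (J * P)) =
          (U : QOp d N) * J * (spectralProj (weyl b) (x - c) * P) := by
        intro x
        rw [← Matrix.mul_assoc (spectralProj _ _), spectralProj_mul_intertwine hb]
        simp only [hJ, Matrix.mul_assoc]
      simp only [hx]
      -- Outcome `x` of `B` is outcome `x - c` of `w(b)`; the branches are relabelled accordingly.
      rw [← Equiv.sum_comp (Equiv.addRight c)]
      simp only [Equiv.coe_addRight, add_sub_cancel_right]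
      by_cases hs : ∃ μ : ℂ, weyl b * P = μ • P
      · obtain ⟨μ, hμ⟩ := hs
        -- The scalar is an eigenvalue of `w(b)`, hence some `ω ^ y`: at least one spectral
        -- component of `P` is nonzero. The outcome is then certain and no node is needed.
        obtain ⟨y, hy⟩ : ∃ y : ZMod d, weyl b * P = (ZMod.stdAddChar y : ℂ) • P := by
          obtain ⟨y, hy⟩ : ∃ y : ZMod d, spectralProj (weyl b) y * P ≠ 0 := by
            by_contra! h0
            apply hP.ne_zero
            rw [← one_mul P, ← sum_spectralProj (d := d) (weyl b), Finset.sum_mul]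
            exact Finset.sum_eq_zero fun x _ => h0 x
          refine ⟨y, ?_⟩
          have h1 : μ • (spectralProj (weyl b) y * P) =
              (ZMod.stdAddChar y : ℂ) • (spectralProj (weyl b) y * P) := by
            rw [← mul_smul_comm, ← hμ, ← mul_assoc,
              ← (commute_spectralProj (Commute.refl (weyl b)) y).eq,
              mul_spectralProj (weyl_pow_d b), smul_mul_assoc]
          rw [hμ, smul_left_injective ℂ hy h1]
        rw [Finset.sum_eq_single y]
        · rw [spectralProj_mul_of_eigen hy, if_pos rfl, LinearMap.comp_assoc]
          exact ih _ N hn h₁ U hU P k hP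
        · intro x _ hxy
          rw [spectralProj_mul_of_eigen hy, if_neg hxy, Matrix.mul_zero, krausMap_zero,
            LinearMap.comp_zero]
        · simp
      · push Not at hs
        obtain ⟨k', rfl, hcode⟩ := hP.measure hbP hs
        -- The only case that spends a measurement: all `d` branches continue on codes of exponent
        -- `k'`, and the convex combinations obtained in them are pulled in front of the node.
        refine sum_mem_convexHull
          (T := fun x => {G | CodeTree d n m (spectralProj (weyl b) x * P) k' G})
          (fun G hG => .node b hbP G hG) fun x => ?_
        rw [LinearMap.comp_assoc]
        exact ih _ N hn h₁ U hU _ k' (hcode x)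
  | @random t n₁ p hp hp1 E hE F hF ih =>
    intro N hn h₁ U hU P k hP
    refine (convex_convexHull ℝ _).mem_of_hasSum hp hp1 (fun j => ih j N hn h₁ U hU P k hP)
      fun f => ?_
    refine hasSum_functional (fun ρ => ?_) f
    exact hF _

end Reduction

/-! ### The decomposition and the bound on rounds. -/

theorem mainTheorem3 (d : ℕ) [Fact d.Prime] (n m : ℕ) (O : QMap d n m)
    (hO : O ∈ stabiliserOperations d n m) :
    O ∈ convexHull ℝ {E : QMap d n m |
      E ∈ stabiliserOperations d n m ∧ IsCodeMeasurementForm E} ∧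
    StabProtocol d m (n : ℕ∞) n O := by
  have h : O ∈ convexHull ℝ {G | CodeTree d n m 1 n G} := by
    -- The trivial dilation: no ancilla, `U = 1`, and the whole space as a code of dimension `d ^
    -- n`. This initial exponent is the bound on the rounds.
    have h1 := StabProtocol.comp_mem_convexHull (n := n) hO n le_rfl le_rfl 1 (one_mem _) 1 n
      (isCode_one d n)
    rwa [padIso_refl, partialTrace_self, Submonoid.coe_one, one_mul, one_mul, krausMap_one,
      LinearMap.id_comp, LinearMap.comp_id] at h1
  have hprot : ∀ G, CodeTree d n m 1 n G → ∀ t : ℕ∞, (n : ℕ∞) ≤ t → StabProtocol d m t n G := by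
    intro G hG t ht
    obtain ⟨E, hE, rfl⟩ := hG.exists_protocol
    rw [krausMap_one, LinearMap.comp_id]
    exact hE t ht
  have hform : {G | CodeTree d n m 1 n G} ⊆ {E : QMap d n m |
      E ∈ stabiliserOperations d n m ∧ IsCodeMeasurementForm E} :=
    fun G hG => And.intro (hprot G hG ⊤ le_top) (CodeTree.isCodeMeasurementForm hG)
  refine ⟨convexHull_mono hform h, ?_⟩
  -- Mixing protocols costs no rounds, so the bound for single trees passes to their convex
  -- combinations.
  exact convexHull_min (fun G hG => hprot G hG _ le_rfl) (convex_stabProtocol _) h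

end
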